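/- Let $\sigma$ be a finite relational signature with constants (finitely many relation symbols, each of positive arity, and finitely many constant symbols), let $k\ge 1$, and let $A,B$ be $\sigma$-structures (possibly infinite or empty). Then the following are equivalent: 1. $A\equiv_{\mathrm{MSO}_k}B$; 2. $\mathrm{tr}(A)\sim_{\mathbb E_k}\mathrm{tr}(B)$; 3. $\mathrm{tr}(A)\sim_{\mathbb E_k^{\mathrm{nc}}}\mathrm{tr}(B)$. The notions are as follows. *Logic.* $A\equiv_{\mathrm{MSO}_k}B$ means that $A$ and $B$ satisfy the same monadic second-order sentences of quantifier rank at most $k$, where element and set quantifiers both count and the atomic formulas are $t=t'$, $t\in X$ and $R(t_1,\dots,t_r)$ for terms $t$ (constants or element variables); there is no equality between sets. *Many-sorted structures.* For a set $S$ of sorts, an $S$-sorted signature $\tau$ has constant symbols $\tau_s$ of each sort $s$ and relation symbols with arities in tuples of sorts. $\mathcal R^S(\tau)$ is the category of $\tau$-structures and families of maps $f_s:A_s\to B_s$ that preserve constants and relations, and $\mathcal R^S_{\mathrm{nc}}(\tau)$ is its wide subcategory of morphisms that send non-constant elements (those that interpret no constant symbol) to non-constant elements. In both categories an embedding is an injective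 morphism that reflects all relations. *Translation.* $\mathrm{tr}(A)$ is the structure with two sorts $\mathbf f,\mathbf m$ given by $\mathrm{tr}(A)_{\mathbf f}=A$, $\mathrm{tr}(A)_{\mathbf m}=\mathcal P(A)$, with the constants and relations of $A$ on sort $\mathbf f$, a relation $e$ of arity $\langle\mathbf f,\mathbf m\rangle$ interpreted as membership, and a relation $I$ of arity $\langle\mathbf f,\mathbf f\rangle$ interpreted as equality. *Comonads.* $\mathbb E_k$ is the comonad on $\mathcal R^S(\tau)$ for which $(\mathbb E_kA)_s$ is the disjoint union of $\tau_s$ and the set of words $[a_1{:}s_1,\dots,a_n{:}s_n]$ with $1\le n\le k$, $a_i\in A_{s_i}$ and $s_n=s$. A constant symbol is interpreted by itself. The counit sends $c\mapsto c^A$ and $[a_1{:}s_1,\dots,a_n{:}s_n]\mapsto a_n$. A tuple is in $R^{\mathbb E_kA}$ iff those of its members that are words are pairwise comparable in the prefix order and its image under the counit is in $R^A$. The coextension $h^*:\mathbb E_kA\to\mathbb E_kB$ of $h:\mathbb E_kA\to B$ fixes constant symbols and sends $[a_1{:}s_1,\dots,a_n{:}s_n]$ to $[h[a_1{:}s_1]{:}s_1,\dots,h[a_1{:}s_1,\dots,a_n{:}s_n]{:}s_n]$.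 The comonad $\mathbb E_k^{\mathrm{nc}}$ on $\mathcal R^S_{\mathrm{nc}}(\tau)$ is defined in the same way, using only words whose letters are all non-constant. *Bisimilarity.* Let $G$ be $\mathbb E_k$ or $\mathbb E_k^{\mathrm{nc}}$. A morphism of $G$-coalgebras is an embedding if its underlying morphism is one. A coalgebra $(P,\alpha)$ is a path if its non-constant elements, ordered by $x\sqsubseteq y$ iff the word $\alpha(x)$ is a prefix of the word $\alpha(y)$, form a finite (possibly empty) linear order. A coalgebra morphism $h:X\to Y$ is a pathwise-embedding if $h\circ p$ is an embedding for every embedding $p$ of a path into $X$. It is open if for all paths $P,Q$ and embeddings $i:P\to Q$, $p:P\to X$, $q:Q\to Y$ with $h\circ p=q\circ i$ there is a coalgebra morphism $d:Q\to X$ with $d\circ i=p$ and $h\circ d=q$. Finally, $X\sim_GY$ means that there are a $G$-coalgebra $W$ and two open pathwise-embeddings, from $W$ to the cofree coalgebra $(GX,\delta_X)$ and from $W$ to the cofree coalgebra $(GY,\delta_Y)$. -/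

import Mathlib

open CategoryTheory

universe u v

namespace MSOGame

/-! ## Comonads in Kleisli form, and bisimilarity -/

/-- A comonad in Kleisli form: an object map, a counit and a coextension operation `f ↦ f^*`
subject to `ε^* = 1`, `ε ∘ f^* = f` and `(g ∘ f^*)^* = g^* ∘ f^*`. -/
structure KleisliComonad (C : Type u) [Category.{v} C] where
  obj : C → C
  counit : ∀ X : C, obj X ⟶ X
  coext : ∀ {X Y : C}, (obj X ⟶ Y) → (obj X ⟶ obj Y)
  coext_counit : ∀ X : C, coext (counit X) = 𝟙 (obj X)
  coext_comp_counit : ∀ {X Y : C} (f : obj X ⟶ Y), coext f ≫ counit Y = f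
  coext_comp_coext : ∀ {X Y Z : C} (f : obj X ⟶ Y) (g : obj Y ⟶ Z),
    coext (coext f ≫ g) = coext f ≫ coext g

/-- The comonad given by a comonad in Kleisli form: `G f = (f ∘ ε)^*` and `δ = (1)^*`. -/
def KleisliComonad.toComonad {C : Type u} [Category.{v} C] (K : KleisliComonad C) :
    Comonad C where
  obj := K.obj
  map f := K.coext (K.counit _ ≫ f)
  map_id X := by rw [Category.comp_id, K.coext_counit]
  map_comp f g := by
    rw [← K.coext_comp_coext, ← Category.assoc, ← Category.assoc, K.coext_comp_counit]
  ε :=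
    { app := K.counit
      naturality := fun _ _ f => K.coext_comp_counit _ }
  δ :=
    { app := fun X => K.coext (𝟙 (K.obj X))
      naturality := fun X Y f => by
        change K.coext (K.counit X ≫ f) ≫ K.coext (𝟙 (K.obj Y)) =
          K.coext (𝟙 (K.obj X)) ≫ K.coext (K.counit (K.obj X) ≫ K.coext (K.counit X ≫ f))
        rw [← K.coext_comp_coext, ← K.coext_comp_coext, ← Category.assoc, K.coext_comp_counit,
          Category.comp_id, Category.id_comp] }
  coassoc X := by
    change K.coext (𝟙 (K.obj X)) ≫ K.coext (K.counit (K.obj X) ≫ K.coext (𝟙 (K.obj X))) =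
      K.coext (𝟙 (K.obj X)) ≫ K.coext (𝟙 (K.obj (K.obj X)))
    rw [← K.coext_comp_coext, ← K.coext_comp_coext, ← Category.assoc, K.coext_comp_counit,
      Category.comp_id, Category.id_comp]
  left_counit X := K.coext_comp_counit _
  right_counit X := by
    change K.coext (𝟙 (K.obj X)) ≫ K.coext (K.counit (K.obj X) ≫ K.counit X) = 𝟙 (K.obj X)
    rw [← K.coext_comp_coext, ← Category.assoc, K.coext_comp_counit, Category.id_comp,
      K.coext_counit]

section Bisim

variable {C : Type u} [Category.{v} C] {G : Comonad C}
  (emb : MorphismProperty C) (path : G.Coalgebra → Prop)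

/-- A coalgebra morphism is an embedding if its underlying morphism is one. -/
def IsEmbedding {X Y : G.Coalgebra} (f : X ⟶ Y) : Prop := emb f.f

/-- Pathwise-embeddings: composites with path embeddings are embeddings. -/
def IsPathwiseEmbedding {X Y : G.Coalgebra} (h : X ⟶ Y) : Prop :=
  ∀ (P : G.Coalgebra) (e : P ⟶ X), path P → IsEmbedding emb e → IsEmbedding emb (e ≫ h)

/-- Open morphisms: each commutative square from an embedding of paths `P ↣ Q` to `h`, whose
vertical sides `P ↣ X` and `Q ↣ Y` are embeddings, has a diagonal filler. -/
def IsOpenMorphism {X Y : G.Coalgebra} (h : X ⟶ Y) : Prop :=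
  ∀ (P Q : G.Coalgebra) (i : P ⟶ Q) (p : P ⟶ X) (q : Q ⟶ Y), path P → path Q →
    IsEmbedding emb i → IsEmbedding emb p → IsEmbedding emb q → p ≫ h = i ≫ q →
      ∃ d : Q ⟶ X, i ≫ d = p ∧ d ≫ h = q

/-- `X` and `Y` are bisimilar for the comonad `G`: there is a span of open pathwise-embeddings
between the cofree coalgebras on `X` and `Y`. -/
def Bisimilar (X Y : C) : Prop :=
  ∃ (R : G.Coalgebra) (f : R ⟶ G.cofree.obj X) (g : R ⟶ G.cofree.obj Y),
    (IsPathwiseEmbedding emb path f ∧ IsOpenMorphism emb path f) ∧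
    (IsPathwiseEmbedding emb path g ∧ IsOpenMorphism emb path g)

end Bisim

/-! ## Many-sorted relational structures with constants -/

/-- A relational signature with constants on the set of sorts `S`. -/
structure MSig (S : Type) where
  Const : S → Type u
  Rel : Type u
  arity : Rel → ℕ
  sort : ∀ R : Rel, Fin (arity R) → S

/-- Many-sorted structures. -/
structure MStruct {S : Type} (σ : MSig.{u} S) where
  carrier : S → Type u
  const : ∀ s, σ.Const s → carrier s
  rel : ∀ R : σ.Rel, (∀ i, carrier (σ.sort R i)) → Prop

namespace MStruct

variable {S : Type} {σ : MSig.{u} S}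

/-- Morphisms of many-sorted structures. -/
@[ext]
structure Hom (A B : MStruct σ) where
  toFun : ∀ s, A.carrier s → B.carrier s
  map_const : ∀ s (c : σ.Const s), toFun s (A.const s c) = B.const s c
  map_rel : ∀ (R : σ.Rel) (x : ∀ i, A.carrier (σ.sort R i)),
    A.rel R x → B.rel R (fun i => toFun _ (x i))

/-- The category of many-sorted structures. -/
instance : Category (MStruct σ) where
  Hom := Hom
  id A := ⟨fun _ a => a, fun _ _ => rfl, fun _ _ h => h⟩
  comp f g :=
    ⟨fun s a => g.toFun s (f.toFun s a), fun s c => by rw [f.map_const, g.map_const],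
      fun R _ h => g.map_rel R _ (f.map_rel R _ h)⟩

/-- `a` is not the interpretation of a constant symbol. -/
def NonConst (A : MStruct σ) {s : S} (a : A.carrier s) : Prop := ∀ c, A.const s c ≠ a

/-- Embeddings: injective homomorphisms that reflect all relations. -/
def embeddings (σ : MSig.{u} S) : MorphismProperty (MStruct σ) := fun A B f =>
  (∀ s, Function.Injective (Hom.toFun f s)) ∧
    ∀ (R : σ.Rel) (x : ∀ i, A.carrier (σ.sort R i)),
      B.rel R (fun i => Hom.toFun f _ (x i)) → A.rel R x

/-- The morphisms that send non-constant elements to non-constant elements. -/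
def ncMorphisms (σ : MSig.{u} S) : MorphismProperty (MStruct σ) := fun A B f =>
  ∀ s (a : A.carrier s), A.NonConst a → B.NonConst (Hom.toFun f s a)

instance : (ncMorphisms σ).IsMultiplicative where
  id_mem _ := fun _ _ h => h
  comp_mem _ _ hf hg := fun s a h => hg s _ (hf s a h)

end MStruct

/-- The wide subcategory of many-sorted structures on the morphisms that send non-constant
elements to non-constant elements. -/
abbrev MStructNC {S : Type} (σ : MSig.{u} S) := WideSubcategory (MStruct.ncMorphisms σ)

/-- Embeddings in the category `MStructNC σ`. -/
def ncEmbeddings {S : Type} (σ : MSig.{u} S) : MorphismProperty (MStructNC σ) :=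
  fun _ _ f => MStruct.embeddings σ f.hom

/-! ## Words -/

/-- `Word L s` is the set of non-empty words `[a₁ : s₁, …, aₙ : sₙ]` with letters `aᵢ ∈ L sᵢ`
and `sₙ = s`. -/
inductive Word {S : Type} (L : S → Type u) : S → Type u
  | single {s : S} (a : L s) : Word L s
  | snoc {t s : S} (w : Word L t) (a : L s) : Word L s

namespace Word

variable {S : Type} {L M : S → Type u}

def length : ∀ {s : S}, Word L s → ℕ
  | _, single _ => 1
  | _, snoc w _ => w.length + 1

/-- The last letter. -/
def last : ∀ {s : S}, Word L s → L s
  | _, single a => a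
  | _, snoc _ a => a

/-- The prefix order. -/
inductive IsPrefix : ∀ {s t : S}, Word L s → Word L t → Prop
  | refl {s : S} (w : Word L s) : IsPrefix w w
  | snoc {s t r : S} {w : Word L s} {v : Word L t} (h : IsPrefix w v) (a : L r) :
      IsPrefix w (v.snoc a)

def Comparable {s t : S} (w : Word L s) (v : Word L t) : Prop := IsPrefix w v ∨ IsPrefix v w

end Word

/-- Words of length at most `k`. -/
def BWord {S : Type} (L : S → Type u) (k : ℕ) (s : S) : Type u :=
  {w : Word L s // w.length ≤ k}

namespace Word

variable {S : Type} {L M N : S → Type u} {k : ℕ}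

/-- The coextension on words: `[a₁, …, aₙ] ↦ [f [a₁], f [a₁, a₂], …, f [a₁, …, aₙ]]`. -/
def coext (f : ∀ s, BWord L k s → M s) : ∀ {s : S} (w : Word L s), w.length ≤ k → Word M s
  | _, single a, h => single (f _ ⟨single a, h⟩)
  | _, snoc w a, h => snoc (coext f w ((Nat.le_succ _).trans h)) (f _ ⟨snoc w a, h⟩)

theorem length_coext (f : ∀ s, BWord L k s → M s) :
    ∀ {s : S} (w : Word L s) (h : w.length ≤ k), (coext f w h).length = w.length
  | _, single _, _ => rfl
  | _, snoc w _, h => congrArg (· + 1) (length_coext f w ((Nat.le_succ _).trans h))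

theorem last_coext (f : ∀ s, BWord L k s → M s) :
    ∀ {s : S} (w : Word L s) (h : w.length ≤ k), (coext f w h).last = f s ⟨w, h⟩
  | _, single _, _ => rfl
  | _, snoc _ _, _ => rfl

theorem coext_last : ∀ {s : S} (w : Word L s) (h : w.length ≤ k),
    coext (fun _ (v : BWord L k _) => v.1.last) w h = w
  | _, single _, _ => rfl
  | _, snoc w a, h => by
      rw [coext, coext_last w]
      rfl

theorem coext_coext (f : ∀ s, BWord L k s → M s) (g : ∀ s, BWord M k s → N s) :
    ∀ {s : S} (w : Word L s) (h : w.length ≤ k) (h' : (coext f w h).length ≤ k),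
      coext g (coext f w h) h' =
        coext (fun s (v : BWord L k s) =>
          g s ⟨coext f v.1 v.2, (length_coext f v.1 v.2).trans_le v.2⟩) w h
  | _, single _, _, _ => rfl
  | _, snoc w a, h, h' => by
      have ih := coext_coext f g w ((Nat.le_succ _).trans h)
        ((length_coext f w _).trans_le ((Nat.le_succ _).trans h))
      change snoc _ _ = snoc _ _
      rw [← ih]
      rfl

theorem IsPrefix.coext (f : ∀ s, BWord L k s → M s) {s t : S} {w : Word L s} {v : Word L t}
    (h : IsPrefix w v) (hw : w.length ≤ k) (hv : v.length ≤ k) :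
    IsPrefix (Word.coext f w hw) (Word.coext f v hv) := by
  induction h with
  | refl w => exact .refl _
  | snoc _ a ih => exact .snoc (ih hw ((Nat.le_succ _).trans hv)) _

end Word

/-- The coextension as a map on words of length at most `k`. -/
def BWord.coext {S : Type} {L M : S → Type u} {k : ℕ} (f : ∀ s, BWord L k s → M s) (s : S)
    (w : BWord L k s) : BWord M k s :=
  ⟨Word.coext f w.1 w.2, (Word.length_coext f w.1 w.2).trans_le w.2⟩

/-! ## The Ehrenfeucht–Fraïssé comonads -/

section EF

variable {S : Type} {σ : MSig.{u} S}

/-- Two elements of `𝔼_k A` are compatible unless they are incomparable words. -/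
def Compatible {C D : Type u} {L : S → Type u} {k : ℕ} {s t : S} :
    C ⊕ BWord L k s → D ⊕ BWord L k t → Prop
  | Sum.inr w, Sum.inr v => w.1.Comparable v.1
  | _, _ => True

theorem Compatible.coext {C D : Type u} {L M : S → Type u} {k : ℕ} (f : ∀ s, BWord L k s → M s)
    {s t : S} : ∀ {x : C ⊕ BWord L k s} {y : D ⊕ BWord L k t}, Compatible x y →
      Compatible (Sum.map id (BWord.coext f s) x) (Sum.map id (BWord.coext f t) y)
  | Sum.inl _, Sum.inl _, _ => trivial
  | Sum.inl _, Sum.inr _, _ => trivial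
  | Sum.inr _, Sum.inl _, _ => trivial
  | Sum.inr _, Sum.inr _, h =>
      h.elim (fun h => Or.inl (h.coext f _ _)) (fun h => Or.inr (h.coext f _ _))

/-- The counit on elements: `c ↦ c^A`, and `[a₁, …, aₙ] ↦ aₙ`. -/
def wordEval (A : MStruct σ) {L : S → Type u} (ι : ∀ s, L s → A.carrier s) (k : ℕ) (s : S) :
    σ.Const s ⊕ BWord L k s → A.carrier s :=
  Sum.elim (A.const s) (fun w => ι s w.1.last)

/-- The structure of words of length at most `k` in the letters `L` of `A` (where `ι` regards
letters as elements of `A`), together with all the constant symbols. A tuple is in the relation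
`R` iff its members that are words are pairwise comparable in the prefix order, and its image
under the counit is in the relation `R` of `A`. -/
abbrev wordStruct (A : MStruct σ) (L : S → Type u) (ι : ∀ s, L s → A.carrier s) (k : ℕ) :
    MStruct σ where
  carrier s := σ.Const s ⊕ BWord L k s
  const _ c := Sum.inl c
  rel R x := (∀ i j, Compatible (x i) (x j)) ∧ A.rel R (fun i => wordEval A ι k _ (x i))

/-- The counit. -/
def wordCounit (A : MStruct σ) (L : S → Type u) (ι : ∀ s, L s → A.carrier s) (k : ℕ) :
    MStruct.Hom (wordStruct A L ι k) A where
  toFun := wordEval A ι k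
  map_const _ _ := rfl
  map_rel _ _ h := h.2

theorem wordEval_coext {A B : MStruct σ} {L M : S → Type u} {ι : ∀ s, L s → A.carrier s}
    {κ : ∀ s, M s → B.carrier s} {k : ℕ} (f : MStruct.Hom (wordStruct A L ι k) B)
    (g : ∀ s, BWord L k s → M s) (hg : ∀ s w, κ s (g s w) = f.toFun s (Sum.inr w)) (s : S) :
    ∀ x : σ.Const s ⊕ BWord L k s,
      wordEval B κ k s (Sum.map id (BWord.coext g s) x) = f.toFun s x
  | Sum.inl c => (f.map_const s c).symm
  | Sum.inr w => (congrArg (κ s) (Word.last_coext g w.1 w.2)).trans (hg s w)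

/-- The coextension of `f`: it fixes the constant symbols, and is the coextension on words. Here
`g` is the restriction of `f` to words. -/
def wordCoext {A B : MStruct σ} {L M : S → Type u} {ι : ∀ s, L s → A.carrier s}
    {κ : ∀ s, M s → B.carrier s} {k : ℕ} (f : MStruct.Hom (wordStruct A L ι k) B)
    (g : ∀ s, BWord L k s → M s) (hg : ∀ s w, κ s (g s w) = f.toFun s (Sum.inr w)) :
    MStruct.Hom (wordStruct A L ι k) (wordStruct B M κ k) where
  toFun s := Sum.map id (BWord.coext g s)
  map_const _ _ := rfl
  map_rel R x hx :=
    ⟨fun i j => (hx.1 i j).coext g, by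
      have h := f.map_rel R x hx
      rwa [← funext (fun i => wordEval_coext f g hg _ (x i))] at h⟩

/-- The many-sorted comonad `𝔼_k`, in Kleisli form. -/
def EFKleisli (σ : MSig.{u} S) (k : ℕ) : KleisliComonad (MStruct σ) where
  obj A := wordStruct A A.carrier (fun _ a => a) k
  counit A := wordCounit A A.carrier (fun _ a => a) k
  coext f := wordCoext f (fun s w => MStruct.Hom.toFun f s (Sum.inr w)) (fun _ _ => rfl)
  coext_counit A := by
    refine MStruct.Hom.ext ?_
    funext s x
    rcases x with c | w
    · rfl
    · exact congrArg Sum.inr (Subtype.ext (Word.coext_last w.1 w.2))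
  coext_comp_counit {A B} f := by
    refine MStruct.Hom.ext ?_
    funext s x
    exact wordEval_coext (A := A) (B := B) (ι := fun _ a => a) (κ := fun _ a => a) f
      (fun s w => MStruct.Hom.toFun f s (Sum.inr w)) (fun _ _ => rfl) s x
  coext_comp_coext f g := by
    refine MStruct.Hom.ext ?_
    funext s x
    rcases x with c | w
    · rfl
    · exact congrArg Sum.inr (Subtype.ext (Word.coext_coext
        (fun s w => MStruct.Hom.toFun f s (Sum.inr w))
        (fun s w => MStruct.Hom.toFun g s (Sum.inr w)) w.1 w.2 _).symm)

/-- The many-sorted Ehrenfeucht–Fraïssé comonad `𝔼_k`. -/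
def EF (σ : MSig.{u} S) (k : ℕ) : Comonad (MStruct σ) := (EFKleisli σ k).toComonad

/-- The non-constant elements of a structure. -/
def ncLetters (A : MStruct σ) (s : S) : Type u := {a : A.carrier s // A.NonConst a}

/-- The object part of `𝔼_k^nc`: words without constant letters. -/
abbrev ncWordStruct (A : MStruct σ) (k : ℕ) : MStruct σ :=
  wordStruct A (ncLetters A) (fun _ a => a.1) k

theorem nonConst_inr (A : MStruct σ) (k : ℕ) (s : S) (w : BWord (ncLetters A) k s) :
    (ncWordStruct A k).NonConst (s := s) (Sum.inr w) :=
  fun _ h => Sum.inl_ne_inr h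

/-- The restriction to words of an nc-morphism out of `𝔼_k^nc A`. -/
def ncRestrict {A : MStruct σ} {B : MStructNC σ} {k : ℕ}
    (f : (⟨ncWordStruct A k⟩ : MStructNC σ) ⟶ B) (s : S) (w : BWord (ncLetters A) k s) :
    ncLetters B.obj s :=
  ⟨MStruct.Hom.toFun f.hom s (Sum.inr w), f.property s _ (nonConst_inr A k s w)⟩

/-- The many-sorted comonad `𝔼_k^nc`, in Kleisli form. -/
def EFncKleisli (σ : MSig.{u} S) (k : ℕ) : KleisliComonad (MStructNC σ) where
  obj A := ⟨ncWordStruct A.obj k⟩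
  counit A := ⟨wordCounit A.obj (ncLetters A.obj) (fun _ a => a.1) k, by
    rintro s (c | w) h
    · exact absurd rfl (h c)
    · exact w.1.last.2⟩
  coext {A B} f := ⟨wordCoext (A := A.obj) (B := B.obj) (ι := fun _ a => a.1)
      (κ := fun _ a => a.1) f.hom (ncRestrict f) (fun _ _ => rfl), by
    rintro s (c | w) h
    · exact absurd rfl (h c)
    · exact nonConst_inr B.obj k s _⟩
  coext_counit A := by
    refine WideSubcategory.hom_ext _ (MStruct.Hom.ext ?_)
    funext s x
    rcases x with c | w
    · rfl
    · exact congrArg Sum.inr (Subtype.ext (Word.coext_last (L := ncLetters A.obj) w.1 w.2))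
  coext_comp_counit {A B} f := by
    refine WideSubcategory.hom_ext _ (MStruct.Hom.ext ?_)
    funext s x
    exact wordEval_coext (A := A.obj) (B := B.obj) (κ := fun _ a => a.1) f.hom (ncRestrict f)
      (fun _ _ => rfl) s x
  coext_comp_coext {A B D} f g := by
    refine WideSubcategory.hom_ext _ (MStruct.Hom.ext ?_)
    funext s x
    rcases x with c | w
    · rfl
    · exact congrArg Sum.inr
        (Subtype.ext (Word.coext_coext (L := ncLetters A.obj) (M := ncLetters B.obj)
          (N := ncLetters D.obj) (ncRestrict f) (ncRestrict g) w.1 w.2 _).symm)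

/-- The no-constant variant `𝔼_k^nc` of the many-sorted Ehrenfeucht–Fraïssé comonad. -/
def EFnc (σ : MSig.{u} S) (k : ℕ) : Comonad (MStructNC σ) := (EFncKleisli σ k).toComonad

/-- The order `x ⊑_α y` of a coalgebra on its non-constant elements: the word `α x` is a prefix of
the word `α y`. -/
def coalgOrder (A : MStruct σ) {L : S → Type u} {k : ℕ}
    (α : ∀ s, A.carrier s → σ.Const s ⊕ BWord L k s) (x y : Σ s, ncLetters A s) : Prop :=
  ∃ w v, α x.1 x.2.1 = Sum.inr w ∧ α y.1 y.2.1 = Sum.inr v ∧ w.1.IsPrefix v.1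

/-- Paths: `⊑_α` is a finite linear order on the (possibly empty) set of non-constant elements. -/
def IsPathMap (A : MStruct σ) {L : S → Type u} {k : ℕ}
    (α : ∀ s, A.carrier s → σ.Const s ⊕ BWord L k s) : Prop :=
  Finite (Σ s, ncLetters A s) ∧ IsLinearOrder (Σ s, ncLetters A s) (coalgOrder A α)

/-- Paths among the coalgebras of `𝔼_k`. -/
def EFPath (σ : MSig.{u} S) (k : ℕ) (X : (EF σ k).Coalgebra) : Prop :=
  IsPathMap (L := X.A.carrier) (k := k) X.A (fun s => MStruct.Hom.toFun X.a s)

/-- Paths among the coalgebras of `𝔼_k^nc`. -/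
def EFncPath (σ : MSig.{u} S) (k : ℕ) (X : (EFnc σ k).Coalgebra) : Prop :=
  IsPathMap (L := ncLetters X.A.obj) (k := k) X.A.obj (fun s => MStruct.Hom.toFun X.a.hom s)

/-- Bisimilarity of many-sorted structures for `𝔼_k`. -/
def EFBisimilar (k : ℕ) (A B : MStruct σ) : Prop :=
  Bisimilar (G := EF σ k) (MStruct.embeddings σ) (EFPath σ k) A B

/-- Bisimilarity of many-sorted structures for `𝔼_k^nc`. -/
def EFncBisimilar (k : ℕ) (A B : MStructNC σ) : Prop :=
  Bisimilar (G := EFnc σ k) (ncEmbeddings σ) (EFncPath σ k) A B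

end EF

/-! ## Monadic second-order logic -/

/-- A one-sorted relational signature with constants. -/
structure Sig where
  Const : Type u
  Rel : Type u
  arity : Rel → ℕ
  arity_pos : ∀ R, 0 < arity R

/-- One-sorted structures. -/
structure RStruct (σ : Sig.{u}) where
  carrier : Type u
  const : σ.Const → carrier
  rel : ∀ R : σ.Rel, (Fin (σ.arity R) → carrier) → Prop

/-- First-order terms with free variables among `Fin n`. -/
inductive Term (σ : Sig.{u}) (n : ℕ) : Type u
  | const (c : σ.Const) : Term σ n
  | var (i : Fin n) : Term σ n

/-- `Formula σ n m` consists of the formulas of monadic second-order logic with `n` free element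
variables and `m` free set variables. A quantifier binds the variable `0` of its body, and the
other free variables are shifted by one. There is no equality between sets. -/
inductive Formula (σ : Sig.{u}) : ℕ → ℕ → Type u
  | falsum {n m : ℕ} : Formula σ n m
  | eq {n m : ℕ} (t t' : Term σ n) : Formula σ n m
  | mem {n m : ℕ} (t : Term σ n) (X : Fin m) : Formula σ n m
  | rel {n m : ℕ} (R : σ.Rel) (t : Fin (σ.arity R) → Term σ n) : Formula σ n m
  | neg {n m : ℕ} (φ : Formula σ n m) : Formula σ n m
  | and {n m : ℕ} (φ ψ : Formula σ n m) : Formula σ n m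
  | exElem {n m : ℕ} (φ : Formula σ (n + 1) m) : Formula σ n m
  | exSet {n m : ℕ} (φ : Formula σ n (m + 1)) : Formula σ n m

/-- The quantifier rank, which counts quantifiers of both kinds. -/
def Formula.rank {σ : Sig.{u}} : ∀ {n m : ℕ}, Formula σ n m → ℕ
  | _, _, .falsum => 0
  | _, _, .eq _ _ => 0
  | _, _, .mem _ _ => 0
  | _, _, .rel _ _ => 0
  | _, _, .neg φ => φ.rank
  | _, _, .and φ ψ => max φ.rank ψ.rank
  | _, _, .exElem φ => φ.rank + 1
  | _, _, .exSet φ => φ.rank + 1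

def Term.eval {σ : Sig.{u}} (A : RStruct σ) {n : ℕ} (v : Fin n → A.carrier) :
    Term σ n → A.carrier
  | .const c => A.const c
  | .var i => v i

/-- Satisfaction under an assignment of elements and of subsets. -/
def Formula.Sat {σ : Sig.{u}} (A : RStruct σ) : ∀ {n m : ℕ}, Formula σ n m →
    (Fin n → A.carrier) → (Fin m → Set A.carrier) → Prop
  | _, _, .falsum, _, _ => False
  | _, _, .eq t t', v, _ => t.eval A v = t'.eval A v
  | _, _, .mem t X, v, V => t.eval A v ∈ V X
  | _, _, .rel R t, v, _ => A.rel R (fun i => (t i).eval A v)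
  | _, _, .neg φ, v, V => ¬ φ.Sat A v V
  | _, _, .and φ ψ, v, V => φ.Sat A v V ∧ ψ.Sat A v V
  | _, _, .exElem φ, v, V =>
      ∃ a : A.carrier, φ.Sat A (Fin.cons (α := fun _ => A.carrier) a v) V
  | _, _, .exSet φ, v, V =>
      ∃ M : Set A.carrier, φ.Sat A v (Fin.cons (α := fun _ => Set A.carrier) M V)

/-- `A ≡ B` for monadic second-order logic of quantifier rank at most `k`. -/
def MSOEquiv {σ : Sig.{u}} (k : ℕ) (A B : RStruct σ) : Prop :=
  ∀ φ : Formula σ 0 0, φ.rank ≤ k →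
    (φ.Sat A Fin.elim0 Fin.elim0 ↔ φ.Sat B Fin.elim0 Fin.elim0)

/-! ## The two-sorted translation -/

/-- The sorts: elements and sets of elements. -/
inductive MSOSort : Type
  | fst
  | snd

/-- The relation symbols of the two-sorted signature: those of `σ`, membership `e` and
equality `I`. -/
inductive MSORel (σ : Sig.{u}) : Type u
  | base (R : σ.Rel) : MSORel σ
  | e : MSORel σ
  | I : MSORel σ

/-- The two-sorted signature of the translation. -/
def msoSig (σ : Sig.{u}) : MSig.{u} MSOSort where
  Const
    | .fst => σ.Const
    | .snd => PEmpty
  Rel := MSORel σ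
  arity
    | .base R => σ.arity R
    | .e => 2
    | .I => 2
  sort
    | .base _ => fun _ => .fst
    | .e => ![.fst, .snd]
    | .I => ![.fst, .fst]

/-- The universe of the standard model on the set `A`: the elements of `A` and its subsets. -/
def stdCarrier (A : Type u) : MSOSort → Type u
  | .fst => A
  | .snd => Set A

/-- The two-sorted standard model of a structure. -/
def trE {σ : Sig.{u}} (A : RStruct σ) : MStruct (msoSig σ) where
  carrier := stdCarrier A.carrier
  const
    | .fst => fun c => A.const c
    | .snd => fun c => c.elim
  rel
    | .base R => fun x => A.rel R x
    | .e => fun x =>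
        let a : A.carrier := x (0 : Fin 2)
        let M : Set A.carrier := x (1 : Fin 2)
        a ∈ M
    | .I => fun x =>
        let a : A.carrier := x (0 : Fin 2)
        let a' : A.carrier := x (1 : Fin 2)
        a = a'

/-- The standard model as an object of the category of the comonad `𝔼_k^nc`. -/
def trEnc {σ : Sig.{u}} (A : RStruct σ) : MStructNC (msoSig σ) := ⟨trE A⟩

end MSOGame

/-! All three relations are compared with the `k`-round Ehrenfeucht–Fraïssé game on the two-sorted
structures, in which a move picks an element or a subset. Duplicator must keep the chosen pairs,
together with the pairs of constants, a partial isomorphism for the relations of `msoSig σ`. As `I`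
is equality of elements and sets carry no equality, this is agreement on the atomic formulas of MSO.

Coalgebras. A coalgebra of `𝔼_k` is a structure whose non-constant elements form a forest of height
at most `k`: such an element has a word ending in itself, every prefix of this word is the word of
its own last letter, and related elements have comparable words (`Branch.of_isPrefix`,
`compat_of_rel`; conversely `mkCoalg`). Paths are the finite chains. A morphism is an open
pathwise-embedding iff it reflects relations on pairwise comparable tuples and every one-step
extension of the image of a branch lifts to an extension of the branch (`open_pathwise_iff`).

Spans and strategies. In a coalgebra of words a one-step extension is the choice of one more letter.
So for a span of open pathwise-embeddings, a branch of the apex records a play, and Duplicator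
answers a move by lifting it along one leg and projecting along the other (`game_spanPairs`).
Conversely, the plays all of whose non-empty prefixes are won by Duplicator form the apex of a span
(`playCoalg`). Together this is `coalgBisimilar_wordCoalg_iff`.

Constants. A letter in the word of an element of a coalgebra is the last letter of a prefix, hence
has a word itself and is not a constant. So `𝔼_k` and `𝔼_k^nc` have equivalent categories of
coalgebras (`forgetNCFunctor`), and bisimilarity for `𝔼_k^nc` becomes the game in which constants
may not be chosen. This game is no easier and no harder (`ncGame_iff_fullGame`): a constant is
answered by the same constant and adds no new pair, while `I` forbids matching a constant with a
non-constant element.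

Logic. A winning strategy preserves formulas of rank at most `k` by induction on formulas
(`sat_iff_of_game`). Conversely, over a finite signature, finitely many formulas of rank at most `r`
decide the `r`-round game (`exists_formulas_game`); they are existential quantifications of complete
conjunctions of literals, as in Hintikka's formulas. -/

namespace MSOGame

/-! ### Words and the prefix order -/

namespace Word

variable {S : Type} {L M N : S → Type u} {k : ℕ}

/-- The letterwise action of a family of maps on words. -/
def map (f : ∀ s, L s → M s) : ∀ {s : S}, Word L s → Word M s
  | s, single a => single (f s a)
  | s, snoc w a => snoc (map f w) (f s a)

theorem length_map (f : ∀ s, L s → M s) : ∀ {s : S} (w : Word L s), (map f w).length = w.length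
  | _, single _ => rfl
  | _, snoc w _ => congrArg (· + 1) (length_map f w)

theorem last_map (f : ∀ s, L s → M s) : ∀ {s : S} (w : Word L s), (map f w).last = f s w.last
  | _, single _ => rfl
  | _, snoc _ _ => rfl

theorem map_map (f : ∀ s, L s → M s) (g : ∀ s, M s → N s) :
    ∀ {s : S} (w : Word L s), map g (map f w) = map (fun s a => g s (f s a)) w
  | _, single _ => rfl
  | _, snoc w _ => by simp only [map, map_map f g w]

theorem map_id : ∀ {s : S} (w : Word L s), map (fun _ a => a) w = w
  | _, single _ => rfl
  | _, snoc w _ => by simp only [map, map_id w]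

theorem IsPrefix.length_le {s t : S} {w : Word L s} {v : Word L t} (h : IsPrefix w v) :
    w.length ≤ v.length := by
  induction h with
  | refl w => exact le_rfl
  | snoc _ a ih => exact ih.trans (Nat.le_succ _)

theorem IsPrefix.trans {r s t : S} {u : Word L r} {w : Word L s} {v : Word L t}
    (h : IsPrefix u w) (h' : IsPrefix w v) : IsPrefix u v := by
  induction h' with
  | refl w => exact h
  | snoc _ a ih => exact .snoc (ih h) a

theorem IsPrefix.eq_of_length_le {s t : S} {w : Word L s} {v : Word L t} (h : IsPrefix w v)
    (hl : v.length ≤ w.length) : (⟨s, w⟩ : Σ s, Word L s) = ⟨t, v⟩ := by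
  cases h with
  | refl w => rfl
  | snoc h a => exact absurd (h.length_le) (by simp only [length] at hl; omega)

theorem IsPrefix.symm_of_length_le {s t : S} {w : Word L s} {v : Word L t} (h : IsPrefix w v)
    (hl : v.length ≤ w.length) : IsPrefix v w := by
  cases h with
  | refl w => exact .refl _
  | snoc h a => exact absurd (h.length_le) (by simp only [length] at hl; omega)

theorem IsPrefix.eq_of_length_eq {s : S} {w v : Word L s} (h : IsPrefix w v)
    (hl : w.length = v.length) : w = v :=
  sigma_mk_injective (h.eq_of_length_le hl.ge)

theorem Comparable.eq_of_length_eq {s : S} {w v : Word L s} (h : Comparable w v)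
    (hl : w.length = v.length) : w = v :=
  h.elim (fun h => h.eq_of_length_eq hl) (fun h => (h.eq_of_length_eq hl.symm).symm)

theorem isPrefix_single {s t : S} {w : Word L s} {a : L t} (h : IsPrefix w (single a)) :
    (⟨s, w⟩ : Σ s, Word L s) = ⟨t, single a⟩ := by
  cases h; rfl

theorem isPrefix_snoc {r s t : S} {w : Word L r} {v : Word L s} {a : L t}
    (h : IsPrefix w (snoc v a)) :
    (⟨r, w⟩ : Σ s, Word L s) = ⟨t, snoc v a⟩ ∨ IsPrefix w v := by
  cases h with
  | refl => exact .inl rfl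
  | snoc h => exact .inr h

/-- The prefixes of one word form a chain; this makes the prefix order a forest order. -/
theorem IsPrefix.comparable {r s t : S} {u : Word L r} {w : Word L s} {v : Word L t}
    (h : IsPrefix u v) (h' : IsPrefix w v) : Comparable u w := by
  induction h with
  | refl v => exact .inr h'
  | snoc h a ih =>
    rcases isPrefix_snoc h' with e | h'
    · cases e
      exact .inl (.snoc h a)
    · exact ih h'

theorem IsPrefix.map (f : ∀ s, L s → M s) {s t : S} {w : Word L s} {v : Word L t}
    (h : IsPrefix w v) : IsPrefix (map f w) (map f v) := by
  induction h with
  | refl w => exact .refl _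
  | snoc _ a ih => exact .snoc ih _

theorem Comparable.map (f : ∀ s, L s → M s) {s t : S} {w : Word L s} {v : Word L t}
    (h : Comparable w v) : Comparable (map f w) (map f v) :=
  h.imp (.map f) (.map f)

theorem exists_of_isPrefix_map (f : ∀ s, L s → M s) : ∀ {s t : S} {w : Word M s} (v : Word L t),
    IsPrefix w (map f v) → ∃ v' : Word L s, IsPrefix v' v ∧ map f v' = w
  | _, _, _, single a, h => by
    cases isPrefix_single h
    exact ⟨_, .refl _, rfl⟩
  | _, _, _, snoc v a, h => by
    rcases isPrefix_snoc h with e | h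
    · cases e
      exact ⟨_, .refl _, rfl⟩
    · obtain ⟨v', h, e⟩ := exists_of_isPrefix_map f v h
      exact ⟨v', .snoc h a, e⟩

theorem exists_of_isPrefix_coext (f : ∀ s, BWord L k s → M s) :
    ∀ {s t : S} {w : Word M s} (v : Word L t) (hv : v.length ≤ k), IsPrefix w (coext f v hv) →
      ∃ (v' : Word L s) (h : IsPrefix v' v), coext f v' (h.length_le.trans hv) = w
  | _, _, _, single a, hv, h => by
    cases isPrefix_single h
    exact ⟨_, .refl _, rfl⟩
  | _, _, _, snoc v a, hv, h => by
    rcases isPrefix_snoc h with e | h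
    · cases e
      exact ⟨_, .refl _, rfl⟩
    · obtain ⟨v', h, e⟩ := exists_of_isPrefix_coext f v _ h
      exact ⟨v', .snoc h a, e⟩

theorem map_injective {f : ∀ s, L s → M s} (hf : ∀ s, Function.Injective (f s)) :
    ∀ {s : S} (w v : Word L s), map f w = map f v → w = v
  | _, single a, single b, h => by
    simp only [map, single.injEq] at h
    rw [hf _ h]
  | _, single a, snoc v b, h => by simp [map] at h
  | _, snoc w a, single b, h => by simp [map] at h
  | _, snoc (t := t) w a, snoc (t := t') v b, h => by
    simp only [map, snoc.injEq] at h
    obtain ⟨rfl, h, h'⟩ := h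
    rw [map_injective hf w v (eq_of_heq h), hf _ h']

theorem IsPrefix.of_map {f : ∀ s, L s → M s} (hf : ∀ s, Function.Injective (f s)) {s t : S}
    {w : Word L s} {v : Word L t} (h : IsPrefix (Word.map f w) (Word.map f v)) :
    IsPrefix w v := by
  obtain ⟨v', h, e⟩ := exists_of_isPrefix_map f v h
  rwa [← map_injective hf _ _ e]

/-- Both sides have the shape of `w`, with one letter for each prefix, so they are compared prefix
by prefix. For `g` the inclusion of words and `f` a structure map this is the coassociativity law at
a word: every prefix is the word of its own last letter. -/
theorem coext_eq_map_iff (g : ∀ s, BWord L k s → M s) (f : ∀ s, L s → M s) :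
    ∀ {s : S} (w : Word L s) (h : w.length ≤ k), coext g w h = map f w ↔
      ∀ (t : S) (v : Word L t) (hv : IsPrefix v w), g t ⟨v, hv.length_le.trans h⟩ = f t v.last
  | _, single a, h => by
    simp only [coext, map, single.injEq]
    constructor
    · intro e t v hv
      cases isPrefix_single hv
      exact e
    · intro e
      exact e _ _ (.refl _)
  | _, snoc w a, h => by
    simp only [coext, map, snoc.injEq, heq_eq_eq, true_and]
    rw [coext_eq_map_iff g f w]
    constructor
    · rintro ⟨e, e'⟩ t v hv
      rcases isPrefix_snoc hv with h | h
      · cases h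
        exact e'
      · exact e t v h
    · intro e
      exact ⟨fun t v hv => e t v (.snoc hv a), e _ _ (.refl _)⟩

theorem coext_last_comp (f : ∀ s, L s → M s) {s : S} (w : Word L s) (h : w.length ≤ k) :
    coext (fun s (v : BWord L k s) => f s v.1.last) w h = map f w :=
  (coext_eq_map_iff _ _ _ _).2 fun _ _ _ => rfl

theorem map_coext (f : ∀ s, BWord L k s → M s) (g : ∀ s, M s → N s) :
    ∀ {s : S} (w : Word L s) (h : w.length ≤ k),
      map g (coext f w h) = coext (fun s v => g s (f s v)) w h
  | _, single _, _ => rfl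
  | _, snoc w _, h => by simp only [map, coext, map_coext f g w]

/-- A word all of whose letters satisfy a predicate lifts to the subtype. -/
theorem exists_lift (D : ∀ s, L s → Prop) : ∀ {s : S} (w : Word L s),
    (∀ (t : S) (v : Word L t), IsPrefix v w → D t v.last) →
      ∃ w' : Word (fun s => {a : L s // D s a}) s, map (fun _ a => a.1) w' = w
  | _, single a, h => ⟨single ⟨a, h _ _ (.refl _)⟩, rfl⟩
  | _, snoc w a, h => by
    obtain ⟨w', e⟩ := exists_lift D w fun t v hv => h t v (.snoc hv a)
    exact ⟨snoc w' ⟨a, h _ _ (.refl _)⟩, by simp only [map, e]⟩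

theorem finite_prefixes : ∀ {s : S} (w : Word L s),
    {v : Σ t, Word L t | IsPrefix v.2 w}.Finite
  | _, single a => (Set.finite_singleton ⟨_, single a⟩).subset fun _ h => isPrefix_single h
  | _, snoc w a => ((finite_prefixes w).insert ⟨_, snoc w a⟩).subset fun _ h => isPrefix_snoc h

/-! ### Possibly empty words, as positions that a letter extends -/

/-- A possibly empty word. -/
abbrev Opt (L : S → Type u) : Type u := Option (Σ t, Word L t)

/-- Appending a letter to a possibly empty word. -/
def append : Opt L → ∀ {s : S}, L s → Word L s
  | none, _, a => single a
  | some w, _, a => snoc w.2 a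

/-- The prefix relation of words to possibly empty words. -/
def Below {s : S} (w : Word L s) (o : Opt L) : Prop := ∃ v, o = some v ∧ IsPrefix w v.2

/-- The action of a family of maps on possibly empty words. -/
def omap (f : ∀ s, L s → M s) (o : Opt L) : Opt M := Option.map (fun w => ⟨w.1, map f w.2⟩) o

def olength : Opt L → ℕ
  | none => 0
  | some w => w.2.length

theorem length_append (o : Opt L) {s : S} (a : L s) : (append o a).length = olength o + 1 := by
  cases o <;> rfl

theorem last_append (o : Opt L) {s : S} (a : L s) : (append o a).last = a := by
  cases o <;> rfl

theorem map_append (f : ∀ s, L s → M s) (o : Opt L) {s : S} (a : L s) :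
    map f (append o a) = append (omap f o) (f s a) := by
  cases o <;> rfl

theorem olength_omap (f : ∀ s, L s → M s) (o : Opt L) : olength (omap f o) = olength o := by
  rcases o with _ | w
  · rfl
  · exact length_map f w.2

theorem omap_omap (f : ∀ s, L s → M s) (g : ∀ s, M s → N s) (o : Opt L) :
    omap g (omap f o) = omap (fun s a => g s (f s a)) o := by
  rcases o with _ | w
  · rfl
  · simp only [omap, Option.map_some, map_map]

theorem Below.of_isPrefix {s t : S} {w : Word L s} {v : Word L t} {o : Opt L}
    (h : Below v o) (h' : IsPrefix w v) : Below w o :=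
  let ⟨u, e, hu⟩ := h
  ⟨u, e, h'.trans hu⟩

theorem Below.comparable {s t : S} {w : Word L s} {v : Word L t} {o : Opt L}
    (h : Below v o) (h' : Below w o) : Comparable v w := by
  obtain ⟨u, rfl, h⟩ := h
  obtain ⟨u', e, h'⟩ := h'
  cases e
  exact h.comparable h'

theorem isPrefix_append {r s : S} {w : Word L r} {o : Opt L} {a : L s}
    (h : IsPrefix w (append o a)) :
    (⟨r, w⟩ : Σ s, Word L s) = ⟨s, append o a⟩ ∨ Below w o := by
  rcases o with _ | v
  · exact .inl (isPrefix_single h)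
  · exact (isPrefix_snoc h).imp_right fun h => ⟨v, rfl, h⟩

theorem Below.append {r s : S} {w : Word L r} {o : Opt L} (h : Below w o) (a : L s) :
    IsPrefix w (append o a) := by
  obtain ⟨v, rfl, h⟩ := h
  exact .snoc h a

theorem exists_eq_append : ∀ {s : S} (w : Word L s), ∃ (o : Opt L), w = append o w.last
  | _, single _ => ⟨none, rfl⟩
  | _, snoc w _ => ⟨some ⟨_, w⟩, rfl⟩

theorem append_injective {s : S} {o o' : Opt L} {a a' : L s} (h : append o a = append o' a') :
    o = o' ∧ a = a' := by
  rcases o with _ | ⟨t, w⟩ <;> rcases o' with _ | ⟨t', w'⟩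
  · cases h
    exact ⟨rfl, rfl⟩
  · cases h
  · cases h
  · cases h
    exact ⟨rfl, rfl⟩

theorem Below.map (f : ∀ s, L s → M s) {s : S} {w : Word L s} {o : Opt L} (h : Below w o) :
    Below (map f w) (omap f o) := by
  obtain ⟨v, rfl, h⟩ := h
  exact ⟨_, rfl, h.map f⟩

end Word

/-! ### Coalgebras of `𝔼_k` as forest-ordered structures -/

section Coalgebras

variable {S : Type} {σ : MSig.{u} S} {k : ℕ}

/-- `f` as a family of functions. -/
abbrev MStruct.fn {A B : MStruct σ} (f : A ⟶ B) (s : S) : A.carrier s → B.carrier s :=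
  MStruct.Hom.toFun f s

theorem MStruct.hom_ext {A B : MStruct σ} {f g : A ⟶ B} (h : ∀ s x, fn f s x = fn g s x) :
    f = g :=
  MStruct.Hom.ext (funext fun s => funext fun x => h s x)

/-- The structure map of a coalgebra. -/
def coalgMap (X : (EF σ k).Coalgebra) (s : S) (x : X.A.carrier s) :
    σ.Const s ⊕ BWord X.A.carrier k s :=
  MStruct.Hom.toFun X.a s x

/-- The word of a non-constant element of a coalgebra. -/
def Branch (X : (EF σ k).Coalgebra) {s : S} (x : X.A.carrier s) (w : Word X.A.carrier s) : Prop :=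
  ∃ h : w.length ≤ k, coalgMap X s x = Sum.inr ⟨w, h⟩

/-- The functor is the coextension of `f ∘ ε`, which replaces each letter by the value of `f` on the
last letter of the prefix ending there: it acts letterwise. -/
theorem fn_EF_map {A B : MStruct σ} (f : A ⟶ B) (s : S)
    (x : σ.Const s ⊕ BWord A.carrier k s) :
    MStruct.fn ((EF σ k).map f) s x =
      Sum.map id (fun w : BWord A.carrier k s =>
        (⟨w.1.map (MStruct.fn f), (Word.length_map _ _).trans_le w.2⟩ : BWord B.carrier k s)) x := by
  rcases x with c | w
  · rfl
  · exact congrArg Sum.inr (Subtype.ext (Word.coext_last_comp (MStruct.fn f) w.1 w.2))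

theorem coalgMap_const (X : (EF σ k).Coalgebra) {s : S} (c : σ.Const s) :
    coalgMap X s (X.A.const s c) = Sum.inl c :=
  MStruct.Hom.map_const X.a s c

theorem eval_coalgMap (X : (EF σ k).Coalgebra) {s : S} (x : X.A.carrier s) :
    wordEval X.A (fun _ a => a) k s (coalgMap X s x) = x :=
  congrArg (fun f => MStruct.fn f s x) X.counit

theorem const_of_coalgMap {X : (EF σ k).Coalgebra} {s : S} {x : X.A.carrier s} {c : σ.Const s}
    (h : coalgMap X s x = Sum.inl c) : X.A.const s c = x := by
  have := eval_coalgMap X x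
  rwa [h] at this

theorem Branch.last {X : (EF σ k).Coalgebra} {s : S} {x : X.A.carrier s}
    {w : Word X.A.carrier s} (h : Branch X x w) : w.last = x := by
  obtain ⟨hw, h⟩ := h
  have := eval_coalgMap X x
  rwa [h] at this

theorem Branch.unique {X : (EF σ k).Coalgebra} {s : S} {x : X.A.carrier s}
    {w v : Word X.A.carrier s} (h : Branch X x w) (h' : Branch X x v) : w = v := by
  obtain ⟨_, h⟩ := h
  obtain ⟨_, h'⟩ := h'
  rw [h] at h'
  exact congrArg Subtype.val (Sum.inr_injective h')

theorem not_branch_const (X : (EF σ k).Coalgebra) {s : S} (c : σ.Const s)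
    (w : Word X.A.carrier s) : ¬ Branch X (X.A.const s c) w := by
  rintro ⟨_, h⟩
  rw [coalgMap_const] at h
  cases h

theorem Branch.nonConst {X : (EF σ k).Coalgebra} {s : S} {x : X.A.carrier s}
    {w : Word X.A.carrier s} (h : Branch X x w) : X.A.NonConst x := by
  rintro c rfl
  exact not_branch_const X c w h

theorem const_or_branch (X : (EF σ k).Coalgebra) {s : S} (x : X.A.carrier s) :
    (∃ c, X.A.const s c = x) ∨ ∃ w, Branch X x w := by
  rcases h : coalgMap X s x with c | w
  · exact .inl ⟨c, const_of_coalgMap h⟩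
  · exact .inr ⟨w.1, w.2, h⟩

theorem const_injective (X : (EF σ k).Coalgebra) {s : S} {c d : σ.Const s}
    (h : X.A.const s c = X.A.const s d) : c = d := by
  have := coalgMap_const X c
  rw [h, coalgMap_const] at this
  exact (Sum.inl_injective this).symm

/-- Coassociativity, read off at the prefix `v` by `coext_eq_map_iff`. -/
theorem Branch.of_isPrefix {X : (EF σ k).Coalgebra} {s t : S} {x : X.A.carrier s}
    {w : Word X.A.carrier s} (h : Branch X x w) {v : Word X.A.carrier t} (hv : v.IsPrefix w) :
    Branch X v.last v := by
  obtain ⟨hw, h⟩ := h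
  have e : MStruct.fn (X.a ≫ (EF σ k).δ.app X.A) s x =
      MStruct.fn (X.a ≫ (EF σ k).map X.a) s x :=
    congrArg (fun f => MStruct.fn f s x) X.coassoc
  change MStruct.fn ((EF σ k).δ.app X.A) s (coalgMap X s x) =
    MStruct.fn ((EF σ k).map X.a) s (coalgMap X s x) at e
  rw [h, fn_EF_map] at e
  have e' := congrArg Subtype.val (Sum.inr_injective e)
  have := (Word.coext_eq_map_iff _ _ _ _).1 e' t v hv
  exact ⟨hv.length_le.trans hw, this.symm⟩

/-- The words of two elements of a coalgebra, if any, are comparable. -/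
def Compat (X : (EF σ k).Coalgebra) {s t : S} (x : X.A.carrier s) (y : X.A.carrier t) : Prop :=
  ∀ w v, Branch X x w → Branch X y v → w.Comparable v

theorem compat_of_rel {X : (EF σ k).Coalgebra} {R : σ.Rel}
    {x : ∀ i, X.A.carrier (σ.sort R i)} (h : X.A.rel R x) (i j) : Compat X (x i) (x j) := by
  rintro w v ⟨_, hw⟩ ⟨_, hv⟩
  have : Compatible (coalgMap X _ (x i)) (coalgMap X _ (x j)) :=
    (MStruct.Hom.map_rel X.a R x h).1 i j
  rwa [hw, hv] at this

/-- A coalgebra from elementary data. -/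
def mkCoalg (A : MStruct σ) (α : ∀ s, A.carrier s → σ.Const s ⊕ BWord A.carrier k s)
    (hc : ∀ s c, α s (A.const s c) = Sum.inl c)
    (hl : ∀ s x, wordEval A (fun _ a => a) k s (α s x) = x)
    (hp : ∀ s x w, α s x = Sum.inr w → ∀ t (v : Word A.carrier t) (hv : v.IsPrefix w.1),
      α t v.last = Sum.inr ⟨v, hv.length_le.trans w.2⟩)
    (hr : ∀ R x, A.rel R x → ∀ i j, Compatible (α _ (x i)) (α _ (x j))) :
    (EF σ k).Coalgebra where
  A := A
  a := (⟨α, hc, fun R x h => ⟨hr R x h, by simpa only [hl] using h⟩⟩ :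
    MStruct.Hom A (wordStruct A A.carrier (fun _ a => a) k))
  counit := MStruct.hom_ext hl
  coassoc := by
    refine MStruct.hom_ext fun s x => ?_
    let a : A ⟶ (EF σ k).obj A :=
      (⟨α, hc, fun R x h => ⟨hr R x h, by simpa only [hl] using h⟩⟩ :
        MStruct.Hom A (wordStruct A A.carrier (fun _ a => a) k))
    change MStruct.fn ((EF σ k).δ.app A) s (α s x) = MStruct.fn ((EF σ k).map a) s (α s x)
    rcases h : α s x with c | w
    · rfl
    · rw [fn_EF_map]
      refine congrArg Sum.inr (Subtype.ext ?_)
      -- Coassociativity on a word is precisely the prefix condition `hp`.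
      exact (Word.coext_eq_map_iff _ _ _ w.2).2 fun t v hv => (hp s x w h t v hv).symm

theorem coalgMap_hom {X Y : (EF σ k).Coalgebra} (f : X ⟶ Y) {s : S} (x : X.A.carrier s) :
    coalgMap Y s (MStruct.fn f.f s x) = Sum.map id (fun w : BWord X.A.carrier k s =>
        (⟨w.1.map (MStruct.fn f.f), (Word.length_map _ _).trans_le w.2⟩ :
          BWord Y.A.carrier k s)) (coalgMap X s x) := by
  rw [← fn_EF_map]
  exact (congrArg (fun f => MStruct.fn f s x) f.h).symm

theorem Branch.map {X Y : (EF σ k).Coalgebra} (f : X ⟶ Y) {s : S} {x : X.A.carrier s}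
    {w : Word X.A.carrier s} (h : Branch X x w) :
    Branch Y (MStruct.fn f.f s x) (w.map (MStruct.fn f.f)) := by
  obtain ⟨hw, h⟩ := h
  exact ⟨(Word.length_map _ _).trans_le hw, by rw [coalgMap_hom, h]; rfl⟩

theorem Compat.of_map {X Y : (EF σ k).Coalgebra} (f : X ⟶ Y) {s t : S} {x : X.A.carrier s}
    {y : X.A.carrier t} (h : Compat X x y) :
    Compat Y (MStruct.fn f.f s x) (MStruct.fn f.f t y) := by
  intro w v hw hv
  rcases const_or_branch X x with ⟨c, rfl⟩ | ⟨w', hw'⟩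
  · rw [MStruct.fn, f.f.map_const] at hw
    exact absurd hw (not_branch_const _ _ _)
  rcases const_or_branch X y with ⟨c, rfl⟩ | ⟨v', hv'⟩
  · rw [MStruct.fn, f.f.map_const] at hv
    exact absurd hv (not_branch_const _ _ _)
  rw [hw.unique (hw'.map f), hv.unique (hv'.map f)]
  exact (h _ _ hw' hv').map _

/-- A coalgebra morphism from elementary data. -/
def mkHom {X Y : (EF σ k).Coalgebra} (f : X.A ⟶ Y.A)
    (hf : ∀ s (x : X.A.carrier s) w, Branch X x w →
      Branch Y (MStruct.fn f s x) (w.map (MStruct.fn f))) : X ⟶ Y where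
  f := f
  h := by
    refine MStruct.hom_ext fun s x => ?_
    change MStruct.fn ((EF σ k).map f) s (coalgMap X s x) = coalgMap Y s (MStruct.fn f s x)
    rw [fn_EF_map]
    rcases h : coalgMap X s x with c | w
    · rw [← const_of_coalgMap h, MStruct.fn, f.map_const, coalgMap_const]
      rfl
    · obtain ⟨_, h'⟩ := hf s x w.1 ⟨w.2, h⟩
      rw [h']
      rfl

theorem Coalgebra.hom_ext {X Y : (EF σ k).Coalgebra} {f g : X ⟶ Y}
    (h : ∀ s x, MStruct.fn f.f s x = MStruct.fn g.f s x) : f = g :=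
  Comonad.Coalgebra.Hom.ext (MStruct.hom_ext h)

end Coalgebras

/-! ### Subcoalgebras on prefix-closed sets -/

section Subcoalgebra

variable {S : Type} {σ : MSig.{u} S} {k : ℕ}

/-- A substructure, given by a predicate that contains the constants. -/
def subStruct (A : MStruct σ) (D : ∀ s, A.carrier s → Prop) (hc : ∀ s c, D s (A.const s c)) :
    MStruct σ where
  carrier s := {x : A.carrier s // D s x}
  const s c := ⟨A.const s c, hc s c⟩
  rel R x := A.rel R fun i => (x i).1

/-- The structure map of a subcoalgebra is known only through its composite with this map;
injectivity pulls the coalgebra laws back from the ambient coalgebra. -/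
theorem map_val_injective {A : MStruct σ} {D : ∀ s, A.carrier s → Prop} {s : S} :
    Function.Injective (Sum.map id (fun w : BWord (fun s => {x : A.carrier s // D s x}) k s =>
      (⟨w.1.map (fun _ a => a.1), (Word.length_map _ _).trans_le w.2⟩ : BWord A.carrier k s)) :
      σ.Const s ⊕ _ → σ.Const s ⊕ _) := by
  refine Function.Injective.sumMap Function.injective_id fun w v h => Subtype.ext ?_
  exact Word.map_injective (fun s => Subtype.val_injective) _ _ (congrArg Subtype.val h)

variable (X : (EF σ k).Coalgebra) (D : ∀ s, X.A.carrier s → Prop)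
  (hc : ∀ s c, D s (X.A.const s c))
  (hd : ∀ s x w, D s x → Branch X x w → ∀ t (v : Word X.A.carrier t), v.IsPrefix w → D t v.last)

-- A letter of the word of `x` is the last letter of a prefix, so closure under prefixes puts all
-- letters into `D` and the word lifts.
include hd in
theorem exists_subCoalgMap (s : S) (x : {x : X.A.carrier s // D s x}) :
    ∃ z : σ.Const s ⊕ BWord (fun s => {x : X.A.carrier s // D s x}) k s,
      Sum.map id (fun w : BWord (fun s => {x : X.A.carrier s // D s x}) k s =>
      (⟨w.1.map (fun _ a => a.1), (Word.length_map _ _).trans_le w.2⟩ : BWord X.A.carrier k s)) z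
        = coalgMap X s x.1 := by
  rcases h : coalgMap X s x.1 with c | w
  · exact ⟨Sum.inl c, rfl⟩
  · obtain ⟨w', e⟩ := Word.exists_lift D w.1 (hd s x.1 w.1 x.2 ⟨w.2, h⟩)
    refine ⟨Sum.inr ⟨w', ?_⟩, congrArg Sum.inr (Subtype.ext e)⟩
    rw [← Word.length_map, e]
    exact w.2

/-- The subcoalgebra on a predicate that contains the constants and is closed under prefixes. -/
noncomputable def subCoalg : (EF σ k).Coalgebra :=
  mkCoalg (subStruct X.A D hc) (fun s x => (exists_subCoalgMap X D hd s x).choose)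
    (fun s c => by
      apply map_val_injective (A := X.A)
      exact (exists_subCoalgMap X D hd s _).choose_spec.trans (coalgMap_const X c))
    (fun s x => by
      have h := (exists_subCoalgMap X D hd s x).choose_spec
      have h' := eval_coalgMap X x.1
      rw [← h] at h'
      apply Subtype.ext
      revert h'
      rcases (exists_subCoalgMap X D hd s x).choose with c | w
      · exact id
      · intro h'
        refine Eq.trans ?_ h'
        exact (Word.last_map (fun _ a => a.1) w.1).symm)
    (fun s x w hw t v hv => by
      apply map_val_injective (A := X.A)
      refine (exists_subCoalgMap X D hd t _).choose_spec.trans ?_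
      have h := (exists_subCoalgMap X D hd s x).choose_spec
      rw [hw] at h
      obtain ⟨hl, h'⟩ := Branch.of_isPrefix ⟨_, h.symm⟩ (hv.map _)
      exact (congrArg (coalgMap X t) (Word.last_map _ v).symm).trans h')
    (fun R x h i j => by
      have h' : Compat X (x i).1 (x j).1 := compat_of_rel (X := X) (R := R) h i j
      have hi := (exists_subCoalgMap X D hd _ (x i)).choose_spec
      have hj := (exists_subCoalgMap X D hd _ (x j)).choose_spec
      revert hi hj
      rcases (exists_subCoalgMap X D hd _ (x i)).choose with c | w <;>
        rcases (exists_subCoalgMap X D hd _ (x j)).choose with d | v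
      · exact fun _ _ => trivial
      · exact fun _ _ => trivial
      · exact fun _ _ => trivial
      · intro hi hj
        exact (h' _ _ ⟨_, hi.symm⟩ ⟨_, hj.symm⟩).imp (.of_map fun _ => Subtype.val_injective)
          (.of_map fun _ => Subtype.val_injective))

theorem branch_subCoalg {s : S} {x : {x : X.A.carrier s // D s x}}
    {w : Word (fun s => {x : X.A.carrier s // D s x}) s} :
    Branch (subCoalg X D hc hd) (s := s) x w ↔ Branch X x.1 (w.map fun _ a => a.1) := by
  have h := (exists_subCoalgMap X D hd s x).choose_spec
  constructor
  · rintro ⟨hw, e⟩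
    change (exists_subCoalgMap X D hd s x).choose = _ at e
    rw [e] at h
    exact ⟨_, h.symm⟩
  · rintro ⟨hw, e⟩
    refine ⟨(Word.length_map _ _).symm.trans_le hw, ?_⟩
    change (exists_subCoalgMap X D hd s x).choose = _
    apply map_val_injective (A := X.A)
    rw [h, e]
    rfl

/-- The inclusion of a subcoalgebra. -/
noncomputable def subIncl : subCoalg X D hc hd ⟶ X :=
  mkHom (⟨fun _ x => x.1, fun _ _ => rfl, fun _ _ h => h⟩ : MStruct.Hom (subStruct X.A D hc) X.A)
    fun _ _ _ h => (branch_subCoalg X D hc hd).1 h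

theorem isEmbedding_subIncl : IsEmbedding (MStruct.embeddings σ) (subIncl X D hc hd) :=
  ⟨fun _ => Subtype.val_injective, fun _ _ h => h⟩

end Subcoalgebra

/-! ### Paths and the subcoalgebra below a position -/

section Paths

variable {S : Type} {σ : MSig.{u} S} {k : ℕ}

theorem EFPath.compat {P : (EF σ k).Coalgebra} (hP : EFPath σ k P) {s t : S}
    (x : P.A.carrier s) (y : P.A.carrier t) : Compat P x y := by
  rintro w v hw hv
  have := hP.2
  have h := hP.2.total ⟨s, x, hw.nonConst⟩ ⟨t, y, hv.nonConst⟩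
  refine h.imp ?_ ?_
  · rintro ⟨w', v', hw', hv', h⟩
    rwa [hw.unique ⟨_, hw'⟩, hv.unique ⟨_, hv'⟩]
  · rintro ⟨w', v', hw', hv', h⟩
    rwa [hv.unique ⟨_, hw'⟩, hw.unique ⟨_, hv'⟩]

theorem exists_branch (X : (EF σ k).Coalgebra) {s : S} (x : ncLetters X.A s) :
    ∃ w, Branch X x.1 w :=
  (const_or_branch X x.1).resolve_left fun ⟨c, h⟩ => x.2 c h

/-- Only totality and finiteness are genuine conditions on a path. Reflexivity and transitivity come
from prefixes, and antisymmetry holds because an element is the last letter of its word. -/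
theorem efPath_of_compat {P : (EF σ k).Coalgebra} (hf : Finite (Σ s, ncLetters P.A s))
    (h : ∀ s t (x : P.A.carrier s) (y : P.A.carrier t), Compat P x y) : EFPath σ k P := by
  refine ⟨hf, ?_⟩
  have hr : ∀ x y : Σ s, ncLetters P.A s, coalgOrder (k := k) P.A
      (fun s => MStruct.Hom.toFun P.a s) x y ↔
      ∃ w v, Branch P x.2.1 w ∧ Branch P y.2.1 v ∧ w.IsPrefix v := by
    intro x y
    constructor
    · rintro ⟨w, v, hw, hv, h⟩
      exact ⟨w.1, v.1, ⟨w.2, hw⟩, ⟨v.2, hv⟩, h⟩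
    · rintro ⟨w, v, ⟨hw, hw'⟩, ⟨hv, hv'⟩, h⟩
      exact ⟨⟨w, hw⟩, ⟨v, hv⟩, hw', hv', h⟩
  refine { refl := fun x => ?_, trans := fun x y z hxy hyz => ?_, antisymm := fun x y hxy hyx => ?_,
           total := fun x y => ?_ }
  · obtain ⟨w, hw⟩ := exists_branch P x.2
    exact (hr x x).2 ⟨w, w, hw, hw, .refl _⟩
  · obtain ⟨w, v, hw, hv, h⟩ := (hr x y).1 hxy
    obtain ⟨v', u, hv', hu, h'⟩ := (hr y z).1 hyz
    rw [← hv.unique hv'] at h'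
    exact (hr x z).2 ⟨w, u, hw, hu, h.trans h'⟩
  · obtain ⟨w, v, hw, hv, h⟩ := (hr x y).1 hxy
    obtain ⟨v', w', hv', hw', h'⟩ := (hr y x).1 hyx
    rw [← hv.unique hv', ← hw.unique hw'] at h'
    have e := h.eq_of_length_le h'.length_le
    obtain ⟨s, x, hx⟩ := x
    obtain ⟨t, y, hy⟩ := y
    have hw := hw.last
    have hv := hv.last
    dsimp only at hw hv e
    obtain ⟨rfl, e⟩ := Sigma.mk.inj e
    rw [eq_of_heq e, hv] at hw
    congr 1
    exact Subtype.ext hw.symm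
  · obtain ⟨w, hw⟩ := exists_branch P x.2
    obtain ⟨v, hv⟩ := exists_branch P y.2
    exact (h _ _ x.2.1 y.2.1 w v hw hv).imp (fun h => (hr x y).2 ⟨w, v, hw, hv, h⟩)
      (fun h => (hr y x).2 ⟨v, w, hv, hw, h⟩)

variable (X : (EF σ k).Coalgebra)

/-- A possibly empty word that is the word of an element, if it is non-empty. -/
def IsPosition (o : Word.Opt X.A.carrier) : Prop := ∀ w, o = some w → Branch X w.2.last w.2

variable {X}

theorem IsPosition.branch {o : Word.Opt X.A.carrier} (ho : IsPosition X o) {s : S}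
    {w : Word X.A.carrier s} (h : w.Below o) : Branch X w.last w := by
  obtain ⟨v, e, h⟩ := h
  exact (ho v e).of_isPrefix h

theorem IsPosition.map {Y : (EF σ k).Coalgebra} (f : X ⟶ Y) {o : Word.Opt X.A.carrier}
    (ho : IsPosition X o) : IsPosition Y (Word.omap (MStruct.fn f.f) o) := by
  rcases o with _ | w
  · rintro _ ⟨⟩
  · rintro _ ⟨⟩
    have := (ho w rfl).map f
    rwa [← Word.last_map (MStruct.fn f.f)] at this

/-- The elements on a position, and the constants. -/
def OnPath (o : Word.Opt X.A.carrier) (s : S) (x : X.A.carrier s) : Prop :=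
  (∃ c, X.A.const s c = x) ∨ ∃ w, Branch X x w ∧ w.Below o

theorem onPath_const (o : Word.Opt X.A.carrier) (s : S) (c : σ.Const s) :
    OnPath o s (X.A.const s c) := .inl ⟨c, rfl⟩

theorem OnPath.below {o : Word.Opt X.A.carrier} {s : S} {x : X.A.carrier s} (h : OnPath o s x)
    {w : Word X.A.carrier s} (hw : Branch X x w) : w.Below o := by
  rcases h with ⟨c, rfl⟩ | ⟨v, hv, h⟩
  · exact absurd hw (not_branch_const _ _ _)
  · rwa [hw.unique hv]

theorem OnPath.last (o : Word.Opt X.A.carrier) (s : S) (x : X.A.carrier s)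
    (w : Word X.A.carrier s) (hx : OnPath o s x) (hw : Branch X x w) (t : S)
    (v : Word X.A.carrier t) (hv : v.IsPrefix w) : OnPath o t v.last :=
  .inr ⟨v, hw.of_isPrefix hv, (hx.below hw).of_isPrefix hv⟩

variable (X) in
/-- The subcoalgebra of the elements on a position. -/
noncomputable def pathCoalg (o : Word.Opt X.A.carrier) : (EF σ k).Coalgebra :=
  subCoalg X (OnPath o) (onPath_const o) (OnPath.last o)

variable (X) in
noncomputable def pathIncl (o : Word.Opt X.A.carrier) : pathCoalg X o ⟶ X :=
  subIncl X (OnPath o) (onPath_const o) (OnPath.last o)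

theorem finite_below (o : Word.Opt X.A.carrier) :
    {v : Σ t, Word X.A.carrier t | v.2.Below o}.Finite := by
  rcases o with _ | w
  · refine Set.Finite.subset Set.finite_empty ?_
    rintro v ⟨_, ⟨⟩, _⟩
  · refine (Word.finite_prefixes w.2).subset ?_
    rintro v ⟨_, ⟨⟩, h⟩
    exact h

/-- Finiteness: an element is recovered from its word, and only finitely many words are below `o`.
Comparability: the words below `o` are prefixes of one word. -/
theorem efPath_pathCoalg (o : Word.Opt X.A.carrier) : EFPath σ k (pathCoalg X o) := by
  refine efPath_of_compat ?_ fun s t x y w v hw hv => ?_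
  · have hb : ∀ x : Σ s, ncLetters (pathCoalg X o).A s, ∃ w, Branch X x.2.1.1 w ∧ w.Below o := by
      rintro ⟨s, x⟩
      obtain ⟨w, hw⟩ := exists_branch _ x
      have := (branch_subCoalg X (OnPath o) (onPath_const o) (OnPath.last o)).1 hw
      exact ⟨_, this, x.1.2.below this⟩
    choose f hf hf' using hb
    have := (finite_below o).to_subtype
    refine Finite.of_injective
      (β := {v : Σ t, Word X.A.carrier t | v.2.Below o}) (fun x => ⟨⟨x.1, f x⟩, hf' x⟩) ?_
    rintro ⟨s, x⟩ ⟨t, y⟩ h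
    have h1 := (hf ⟨s, x⟩).last
    have h2 := (hf ⟨t, y⟩).last
    have h := congrArg Subtype.val h
    dsimp only at h h1 h2
    obtain ⟨rfl, h⟩ := Sigma.mk.inj h
    rw [eq_of_heq h, h2] at h1
    congr 1
    exact Subtype.ext (Subtype.ext h1.symm)
  · have hw' := (branch_subCoalg X (OnPath o) (onPath_const o) (OnPath.last o)).1 hw
    have hv' := (branch_subCoalg X (OnPath o) (onPath_const o) (OnPath.last o)).1 hv
    have h := (OnPath.below x.2 hw').comparable (OnPath.below y.2 hv')
    exact h.imp (.of_map fun _ => Subtype.val_injective) (.of_map fun _ => Subtype.val_injective)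

/-- Pairwise compatible tuples lie on a common position. -/
theorem exists_position {n : ℕ} {r : Fin n → S} (x : ∀ i, X.A.carrier (r i))
    (h : ∀ i j, Compat X (x i) (x j)) :
    ∃ o, IsPosition X o ∧ ∀ i, OnPath o _ (x i) := by
  classical
  let J : Finset (Fin n) := Finset.univ.filter fun i => ∃ w, Branch X (x i) w
  have hJ : ∀ i, ∃ m, ∀ w, Branch X (x i) w → w.length = m := by
    intro i
    rcases const_or_branch X (x i) with ⟨c, hc⟩ | ⟨w, hw⟩
    · exact ⟨0, fun w hw => absurd hw (hc ▸ not_branch_const _ _ _)⟩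
    · exact ⟨_, fun v hv => by rw [hv.unique hw]⟩
  choose ℓ hℓ using hJ
  rcases J.eq_empty_or_nonempty with hJ | hJ
  · refine ⟨none, by rintro _ ⟨⟩, fun i => (const_or_branch X (x i)).imp_right fun hw => ?_⟩
    have : i ∈ J := Finset.mem_filter.2 ⟨Finset.mem_univ _, hw⟩
    rw [hJ] at this
    exact absurd this (Finset.notMem_empty _)
  -- A member with a longest word: every other word in the tuple is comparable with it and no
  -- longer, hence is a prefix of it.
  · obtain ⟨i, hi, hmax⟩ := J.exists_max_image ℓ hJ
    obtain ⟨w, hw⟩ := (Finset.mem_filter.1 hi).2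
    refine ⟨some ⟨_, w⟩, ?_, fun j => (const_or_branch X (x j)).imp_right ?_⟩
    · rintro _ ⟨⟩
      exact hw.of_isPrefix (.refl _)
    · rintro ⟨v, hv⟩
      refine ⟨v, hv, _, rfl, ?_⟩
      rcases h j i v w hv hw with h | h
      · exact h
      · have := hmax j (Finset.mem_filter.2 ⟨Finset.mem_univ _, v, hv⟩)
        rw [← hℓ j v hv, ← hℓ i w hw] at this
        exact h.symm_of_length_le this

end Paths

/-! ### Open pathwise-embeddings in elementary terms -/

section Criterion

variable {S : Type} {σ : MSig.{u} S} {k : ℕ} {X Y : (EF σ k).Coalgebra}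

/-- A coalgebra morphism reflects relations on tuples of pairwise comparable elements. -/
def ReflectsComparable (h : X ⟶ Y) : Prop :=
  ∀ R (x : ∀ i, X.A.carrier (σ.sort R i)), (∀ i j, Compat X (x i) (x j)) →
    Y.A.rel R (fun i => MStruct.fn h.f _ (x i)) → X.A.rel R x

/-- One-step extensions of the image of a position lift to extensions of the position. -/
def LiftsExtensions (h : X ⟶ Y) : Prop :=
  ∀ o, IsPosition X o → ∀ s (y : Y.A.carrier s),
    Branch Y y (Word.append (Word.omap (MStruct.fn h.f) o) y) →
      ∃ x, Branch X x (Word.append o x) ∧ MStruct.fn h.f s x = y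

/-- Injectivity on paths is automatic. Morphisms preserve the lengths of words, and comparable words
of equal length coincide; constants are kept apart from words and from each other by the structure
map. -/
theorem IsPathwiseEmbedding.of_reflectsComparable {h : X ⟶ Y} (hr : ReflectsComparable h) :
    IsPathwiseEmbedding (MStruct.embeddings σ) (EFPath σ k) h := by
  intro P e hP he
  refine ⟨fun s x y hxy => ?_, fun R x hx => he.2 R x (hr R _ ?_ hx)⟩
  · change MStruct.fn (e ≫ h).f s x = MStruct.fn (e ≫ h).f s y at hxy
    rcases const_or_branch P x with ⟨c, rfl⟩ | ⟨w, hw⟩ <;>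
      rcases const_or_branch P y with ⟨d, rfl⟩ | ⟨v, hv⟩
    · rw [MStruct.fn, MStruct.Hom.map_const, MStruct.Hom.map_const] at hxy
      rw [const_injective Y hxy]
    · have := hv.map (e ≫ h)
      rw [← hxy, MStruct.fn, MStruct.Hom.map_const] at this
      exact absurd this (not_branch_const _ _ _)
    · have := hw.map (e ≫ h)
      rw [hxy, MStruct.fn, MStruct.Hom.map_const] at this
      exact absurd this (not_branch_const _ _ _)
    · have h' := hw.map (e ≫ h)
      rw [hxy] at h'
      have hl := congrArg Word.length (h'.unique (hv.map (e ≫ h)))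
      rw [Word.length_map, Word.length_map] at hl
      rw [← hw.last, ← hv.last, (hP.compat x y w v hw hv).eq_of_length_eq hl]
  · exact fun i j => (hP.compat (x i) (x j)).of_map e

/-- A pairwise comparable tuple lies on a single path, whose inclusion is a path embedding, so
reflection can be tested there. -/
theorem ReflectsComparable.of_isPathwiseEmbedding {h : X ⟶ Y}
    (hp : IsPathwiseEmbedding (MStruct.embeddings σ) (EFPath σ k) h) : ReflectsComparable h := by
  intro R x hx hY
  obtain ⟨o, ho, hox⟩ := exists_position x hx
  have := hp (pathCoalg X o) (pathIncl X o) (efPath_pathCoalg o) (isEmbedding_subIncl _ _ _ _)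
  exact this.2 R (fun i => ⟨x i, hox i⟩) hY

section Lifting

variable {Q : (EF σ k).Coalgebra} {h : X ⟶ Y} {q : Q ⟶ Y}

theorem branch_last_of_append {o : Word.Opt X.A.carrier} {s : S} {x : X.A.carrier s}
    (hx : Branch X x (Word.append o x)) :
    Branch X (Word.append o x).last (Word.append o x) := by
  rwa [Word.last_append]

variable (pick : ∀ (o : Word.Opt X.A.carrier), IsPosition X o → ∀ s (y : Q.A.carrier s),
  Branch Y (MStruct.fn q.f s y)
    (Word.append (Word.omap (MStruct.fn h.f) o) (MStruct.fn q.f s y)) →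
  {x : X.A.carrier s // Branch X x (Word.append o x) ∧ MStruct.fn h.f s x = MStruct.fn q.f s y})

/-- The lift of a word along `h` by means of choices of extensions. -/
def liftWord : ∀ {s : S} (v : Word Q.A.carrier s), Branch Q v.last v →
    {w : Word X.A.carrier s // Branch X w.last w ∧
      w.map (MStruct.fn h.f) = v.map (MStruct.fn q.f)}
  | _, .single y, hv =>
    let x := pick none (by rintro _ ⟨⟩) _ y (hv.map q)
    ⟨.single x.1, x.2.1, congrArg Word.single x.2.2⟩
  | _, .snoc v y, hv =>
    let w := liftWord v (hv.of_isPrefix (.snoc (.refl _) _))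
    let x := pick (some ⟨_, w.1⟩) (by rintro _ ⟨⟩; exact w.2.1) _ y (by
      have := hv.map q
      simp only [Word.omap, Option.map_some, Word.append, w.2.2]
      exact this)
    ⟨.snoc w.1 x.1, x.2.1, by rw [Word.map, w.2.2, x.2.2]; rfl⟩

/-- The recursion lifts a word by extending the lift of its prefix, so the lift depends letter by
letter on the last letters of the lifted prefixes, and these are the values of `d`. -/
theorem liftWord_eq_map (d : ∀ s, Q.A.carrier s → X.A.carrier s)
    (hd : ∀ s (w : Word Q.A.carrier s) (hw : Branch Q w.last w),
      d s w.last = (liftWord pick w hw).1.last) :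
    ∀ {s : S} (v : Word Q.A.carrier s) (hv : Branch Q v.last v),
      (liftWord pick v hv).1 = v.map d
  | _, .single y, hv => by
    have := hd _ _ hv
    simp only [liftWord, Word.last, Word.map] at this ⊢
    rw [this]
  | _, .snoc v y, hv => by
    have := hd _ _ hv
    have ih := liftWord_eq_map d hd v (hv.of_isPrefix (.snoc (.refl _) _))
    simp only [liftWord, Word.last, Word.map] at this ⊢
    exact congrArg₂ Word.snoc ih this.symm

/-- If the choices follow `p` whenever `p` gives an admissible extension, then by induction the lift
of a word from `P` never leaves the image of `p`. This gives the upper triangle `i ≫ d = p`. -/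
theorem liftWord_map {P : (EF σ k).Coalgebra} {i : P ⟶ Q} {p : P ⟶ X} (hpi : p ≫ h = i ≫ q)
    (hpick : ∀ o ho s (z : P.A.carrier s) hz,
      Branch X (MStruct.fn p.f s z) (Word.append o (MStruct.fn p.f s z)) →
        (pick o ho s (MStruct.fn i.f s z) hz).1 = MStruct.fn p.f s z) :
    ∀ {s : S} (u : Word P.A.carrier s) (_ : Branch P u.last u)
      (hu : Branch Q (u.map (MStruct.fn i.f)).last (u.map (MStruct.fn i.f))),
      (liftWord pick (u.map (MStruct.fn i.f)) hu).1 = u.map (MStruct.fn p.f)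
  | _, .single z, hz, hu => by
    exact congrArg Word.single (hpick none _ _ z _ (hz.map p))
  | _, .snoc u z, hz, hu => by
    have ih := liftWord_map hpi hpick u (hz.of_isPrefix (.snoc (.refl _) _))
      (hu.of_isPrefix (.snoc (.refl _) _))
    refine congrArg₂ Word.snoc ih (hpick _ _ _ z _ ?_)
    have := hz.map p
    rw [Word.map, ← ih] at this
    exact this

end Lifting

/-- The filler is built along the words of `Q`: once a prefix has been lifted to a position of `X`,
its next letter is lifted by extending that position. Relations then come back from `Y` by
reflection. -/
theorem IsOpenMorphism.of_liftsExtensions {h : X ⟶ Y} (hr : ReflectsComparable h)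
    (hl : LiftsExtensions h) : IsOpenMorphism (MStruct.embeddings σ) (EFPath σ k) h := by
  classical
  intro P Q i p q _ _ hi _ _ hpi
  -- The extension prescribed by `p` takes precedence; it is unambiguous because `i` is injective.
  -- In all other cases any lifted extension will do.
  have hpick : ∀ (o : Word.Opt X.A.carrier), IsPosition X o → ∀ s (y : Q.A.carrier s),
      Branch Y (MStruct.fn q.f s y)
        (Word.append (Word.omap (MStruct.fn h.f) o) (MStruct.fn q.f s y)) →
      ∃ x, (Branch X x (Word.append o x) ∧ MStruct.fn h.f s x = MStruct.fn q.f s y) ∧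
        ∀ z, MStruct.fn i.f s z = y →
          Branch X (MStruct.fn p.f s z) (Word.append o (MStruct.fn p.f s z)) →
          x = MStruct.fn p.f s z := by
    intro o ho s y hy
    by_cases H : ∃ z, MStruct.fn i.f s z = y ∧
        Branch X (MStruct.fn p.f s z) (Word.append o (MStruct.fn p.f s z))
    · obtain ⟨z, rfl, hz⟩ := H
      refine ⟨MStruct.fn p.f s z, ⟨hz, ?_⟩, fun z' hz' _ => ?_⟩
      · exact congrArg (fun f : P ⟶ Y => MStruct.fn f.f s z) hpi
      · rw [hi.1 s hz']
    · obtain ⟨x, hx⟩ := hl o ho s _ hy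
      exact ⟨x, hx, fun z hz hz' => absurd ⟨z, hz, hz'⟩ H⟩
  choose pick hp1 hp2 using hpick
  let pick' : ∀ (o : Word.Opt X.A.carrier), IsPosition X o → ∀ s (y : Q.A.carrier s),
      Branch Y (MStruct.fn q.f s y)
        (Word.append (Word.omap (MStruct.fn h.f) o) (MStruct.fn q.f s y)) →
      {x : X.A.carrier s //
        Branch X x (Word.append o x) ∧ MStruct.fn h.f s x = MStruct.fn q.f s y} :=
    fun o ho s y hy => ⟨pick o ho s y hy, hp1 o ho s y hy⟩
  -- Uniqueness of words makes this a definition of `d` on elements: constants go to constants, and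
  -- an element with a word goes to the last letter of the lifted word.
  have hd : ∀ s (y : Q.A.carrier s), ∃ x : X.A.carrier s,
      (∀ c, y = Q.A.const s c → x = X.A.const s c) ∧
      ∀ w (hw : Branch Q w.last w), w.last = y → x = (liftWord pick' w hw).1.last := by
    intro s y
    rcases const_or_branch Q y with ⟨c, rfl⟩ | ⟨w, hw⟩
    · refine ⟨X.A.const s c, fun d hd => by rw [const_injective Q hd], fun w hw e => ?_⟩
      rw [e] at hw
      exact absurd hw (not_branch_const _ _ _)
    · obtain rfl := hw.last
      refine ⟨(liftWord pick' w hw).1.last, fun c hc => ?_, fun v hv e => ?_⟩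
      · exact absurd hc.symm (hw.nonConst c)
      · have hv' := hv
        rw [e] at hv'
        obtain rfl := hw.unique hv'
        rfl
  choose d hdc hdw using hd
  have hdm : ∀ {s} (w : Word Q.A.carrier s) (hw : Branch Q w.last w),
      (liftWord pick' w hw).1 = w.map d :=
    fun w hw => liftWord_eq_map pick' d (fun s w hw => hdw s _ w hw rfl) w hw
  have hdb : ∀ s (y : Q.A.carrier s) w, Branch Q y w → Branch X (d s y) (w.map d) := by
    intro s y w hw
    obtain rfl := hw.last
    have := (liftWord pick' w hw).2.1
    rwa [hdm, Word.last_map] at this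
  have hdh : ∀ s (y : Q.A.carrier s), MStruct.fn h.f s (d s y) = MStruct.fn q.f s y := by
    intro s y
    rcases const_or_branch Q y with ⟨c, rfl⟩ | ⟨w, hw⟩
    · rw [hdc s _ c rfl, MStruct.fn, MStruct.fn, MStruct.Hom.map_const, MStruct.Hom.map_const]
    · obtain rfl := hw.last
      have := congrArg Word.last (liftWord pick' w hw).2.2
      rwa [hdm, Word.last_map, Word.last_map, Word.last_map] at this
  -- A related tuple of `Q` has comparable words, hence so has its image under `d`; since `h ∘ d =
  -- q`, the relation holds in `Y` and is reflected.
  let dH : MStruct.Hom Q.A X.A := ⟨d, fun s c => hdc s _ c rfl, fun R y hy => by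
    refine hr R _ (fun i j w v hw hv => ?_) ?_
    · rcases const_or_branch Q (y i) with ⟨c, hc⟩ | ⟨w', hw'⟩
      · rw [hdc _ _ c hc.symm] at hw
        exact absurd hw (not_branch_const _ _ _)
      rcases const_or_branch Q (y j) with ⟨c, hc⟩ | ⟨v', hv'⟩
      · rw [hdc _ _ c hc.symm] at hv
        exact absurd hv (not_branch_const _ _ _)
      rw [hw.unique (hdb _ _ _ hw'), hv.unique (hdb _ _ _ hv')]
      exact (compat_of_rel hy i j _ _ hw' hv').map d
    · simp only [hdh]
      exact q.f.map_rel R y hy⟩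
  refine ⟨mkHom (X := Q) (Y := X) dH hdb, Coalgebra.hom_ext fun s z => ?_,
    Coalgebra.hom_ext hdh⟩
  change d s (MStruct.fn i.f s z) = MStruct.fn p.f s z
  rcases const_or_branch P z with ⟨c, rfl⟩ | ⟨u, hu⟩
  · refine (hdc s _ c ?_).trans ?_
    · exact MStruct.Hom.map_const _ _ _
    · exact (MStruct.Hom.map_const _ _ _).symm
  · have hui := hu.map i
    obtain rfl := hu.last
    rw [← Word.last_map (MStruct.fn i.f)] at hui
    have e := liftWord_map pick' hpi (fun o ho s z hz hz' => hp2 o ho s _ hz z rfl hz') u hu hui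
    rw [hdm] at e
    have := congrArg Word.last e
    rwa [Word.last_map, Word.last_map, Word.last_map] at this

/-- A morphism restricts to subcoalgebras on positions. -/
theorem exists_pathMap (h : X ⟶ Y) (o : Word.Opt X.A.carrier) (o' : Word.Opt Y.A.carrier)
    (ho : ∀ {s} (w : Word Y.A.carrier s), w.Below (Word.omap (MStruct.fn h.f) o) → w.Below o') :
    ∃ i : pathCoalg X o ⟶ pathCoalg Y o', pathIncl X o ≫ h = i ≫ pathIncl Y o' := by
  have hD : ∀ s (x : X.A.carrier s), OnPath o s x → OnPath o' s (MStruct.fn h.f s x) := by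
    rintro s x (⟨c, rfl⟩ | ⟨w, hw, hb⟩)
    · exact .inl ⟨c, (MStruct.Hom.map_const _ _ _).symm⟩
    · exact .inr ⟨_, hw.map h, ho _ (hb.map _)⟩
  let f : MStruct.Hom (pathCoalg X o).A (pathCoalg Y o').A :=
    ⟨fun s x => ⟨MStruct.fn h.f s x.1, hD s x.1 x.2⟩,
      fun s c => Subtype.ext (h.f.map_const s c), fun R x hx => h.f.map_rel R _ hx⟩
  refine ⟨mkHom (X := pathCoalg X o) (Y := pathCoalg Y o') f fun s x w hw => ?_, rfl⟩
  have hw' := ((branch_subCoalg X (OnPath o) (onPath_const o) (OnPath.last o)).1 hw).map h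
  have e : Word.map (MStruct.fn h.f) (Word.map (fun _ a => a.1) w) =
      Word.map (MStruct.fn (pathIncl Y o').f) (Word.map (MStruct.fn f) w) :=
    (Word.map_map (fun _ a => a.1) _ w).trans
      (Word.map_map (MStruct.fn f) (MStruct.fn (pathIncl Y o').f) w).symm
  exact (branch_subCoalg Y (OnPath o') (onPath_const o') (OnPath.last o')).2
    ((congrArg (Branch Y _) e).mp hw')

/-- Openness is applied to the path of `o` inside the path of its image extended by `y`. The filler
sends the new top element to the required extension of `o`. -/
theorem LiftsExtensions.of_isOpenMorphism {h : X ⟶ Y}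
    (hp : IsPathwiseEmbedding (MStruct.embeddings σ) (EFPath σ k) h)
    (ho : IsOpenMorphism (MStruct.embeddings σ) (EFPath σ k) h) : LiftsExtensions h := by
  intro o hpo s y hy
  let o' : Word.Opt Y.A.carrier := some ⟨s, Word.append (Word.omap (MStruct.fn h.f) o) y⟩
  obtain ⟨i, hi⟩ := exists_pathMap h o o' fun w hw => ⟨_, rfl, hw.append y⟩
  have hq : IsEmbedding (MStruct.embeddings σ) (pathIncl Y o') := isEmbedding_subIncl _ _ _ _
  have hX : IsEmbedding (MStruct.embeddings σ) (pathIncl X o) := isEmbedding_subIncl _ _ _ _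
  -- Followed by the inclusion into `Y`, `i` is `h` restricted to a path, hence an embedding; so `i`
  -- is one too.
  have hiE : IsEmbedding (MStruct.embeddings σ) i := by
    have := hp _ (pathIncl X o) (efPath_pathCoalg o) hX
    rw [hi] at this
    refine ⟨fun s a b hab => this.1 s (congrArg (MStruct.fn (pathIncl Y o').f s) hab),
      fun R x hx => this.2 R x ((pathIncl Y o').f.map_rel R _ hx)⟩
  obtain ⟨d, hd, hd'⟩ := ho _ _ i (pathIncl X o) (pathIncl Y o') (efPath_pathCoalg o)
    (efPath_pathCoalg o') hiE hX hq hi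
  let y' : (pathCoalg Y o').A.carrier s := ⟨y, .inr ⟨_, hy, _, rfl, .refl _⟩⟩
  refine ⟨MStruct.fn d.f s y', ?_, congrArg (fun f => MStruct.fn f.f s y') hd'⟩
  -- the word of `y'`
  have hb : ∀ t (v : Word X.A.carrier t), v.Below o → OnPath o t v.last :=
    fun t v hv => .inr ⟨v, hpo.branch hv, hv⟩
  -- The position `o` is relifted to its own path coalgebra, where `i` and `d` can act on it.
  obtain ⟨o₁, ho₁⟩ : ∃ o₁ : Word.Opt (pathCoalg X o).A.carrier,
      Word.omap (MStruct.fn (pathIncl X o).f) o₁ = o := by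
    rcases o with _ | ⟨t, w⟩
    · exact ⟨none, rfl⟩
    · obtain ⟨w', e⟩ := Word.exists_lift (OnPath (some ⟨t, w⟩)) w
        fun t v hv => hb t v ⟨_, rfl, hv⟩
      exact ⟨some ⟨t, w'⟩, congrArg (fun w => (some ⟨t, w⟩ : Word.Opt X.A.carrier)) e⟩
  have hy' : Branch (pathCoalg Y o') y' (Word.append (Word.omap (MStruct.fn i.f) o₁) y') := by
    refine (branch_subCoalg Y (OnPath o') (onPath_const o') (OnPath.last o')).2 ?_
    have e : Word.omap (MStruct.fn (pathIncl Y o').f) (Word.omap (MStruct.fn i.f) o₁) =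
        Word.omap (MStruct.fn h.f) o := by
      conv_rhs => rw [← ho₁]
      rw [Word.omap_omap, Word.omap_omap]
      exact congrArg (fun f => Word.omap (MStruct.fn f.f) o₁) hi.symm
    have e' := Word.map_append (MStruct.fn (pathIncl Y o').f)
      (Word.omap (MStruct.fn i.f) o₁) y'
    rw [e] at e'
    exact e'.symm ▸ hy
  have := hy'.map d
  rw [Word.map_append, Word.omap_omap] at this
  have e : Word.omap (fun s a => MStruct.fn d.f s (MStruct.fn i.f s a)) o₁ = o := by
    conv_rhs => rw [← ho₁]
    exact congrArg (fun f => Word.omap (MStruct.fn f.f) o₁) hd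
  rwa [e] at this

theorem open_pathwise_iff {h : X ⟶ Y} :
    (IsPathwiseEmbedding (MStruct.embeddings σ) (EFPath σ k) h ∧
      IsOpenMorphism (MStruct.embeddings σ) (EFPath σ k) h) ↔
    ReflectsComparable h ∧ LiftsExtensions h :=
  ⟨fun h => ⟨.of_isPathwiseEmbedding h.1, .of_isOpenMorphism h.1 h.2⟩,
    fun h => ⟨.of_reflectsComparable h.1, .of_liftsExtensions h.1 h.2⟩⟩

end Criterion

/-! ### Bisimilarity along equivalences of categories of coalgebras -/

section Transfer

variable {C : Type u} [Category.{v} C] {G : Comonad C}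

/-- Spans of open pathwise-embeddings between two coalgebras. -/
def CoalgBisimilar (emb : MorphismProperty C) (path : G.Coalgebra → Prop) (X Y : G.Coalgebra) :
    Prop :=
  ∃ (R : G.Coalgebra) (f : R ⟶ X) (g : R ⟶ Y),
    (IsPathwiseEmbedding emb path f ∧ IsOpenMorphism emb path f) ∧
    (IsPathwiseEmbedding emb path g ∧ IsOpenMorphism emb path g)

variable {D : Type u} [Category.{v} D] {H : Comonad D}
  {emb : MorphismProperty C} {path : G.Coalgebra → Prop}
  {emb' : MorphismProperty D} {path' : H.Coalgebra → Prop} [emb'.RespectsIso]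

theorem isEmbedding_iso_comp {X Y Z : H.Coalgebra} (e : X ≅ Y) (f : Y ⟶ Z) :
    IsEmbedding emb' (e.hom ≫ f) ↔ IsEmbedding emb' f :=
  have : IsIso e.hom.f := (H.forget.mapIso e).isIso_hom
  emb'.cancel_left_of_respectsIso e.hom.f f.f

theorem isEmbedding_comp_iso {X Y Z : H.Coalgebra} (f : X ⟶ Y) (e : Y ≅ Z) :
    IsEmbedding emb' (f ≫ e.hom) ↔ IsEmbedding emb' f :=
  have : IsIso e.hom.f := (H.forget.mapIso e).isIso_hom
  emb'.cancel_right_of_respectsIso f.f e.hom.f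

theorem IsPathwiseEmbedding.iso_comp {X Y Z : H.Coalgebra} (e : X ≅ Y) {f : Y ⟶ Z}
    (hf : IsPathwiseEmbedding emb' path' f) : IsPathwiseEmbedding emb' path' (e.hom ≫ f) := by
  intro P p hP hp
  rw [← Category.assoc]
  exact hf P _ hP ((isEmbedding_comp_iso p e).2 hp)

theorem IsOpenMorphism.iso_comp {X Y Z : H.Coalgebra} (e : X ≅ Y) {f : Y ⟶ Z}
    (hf : IsOpenMorphism emb' path' f) : IsOpenMorphism emb' path' (e.hom ≫ f) := by
  intro P Q i p q hP hQ hi hp hq h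
  obtain ⟨d, hd, hd'⟩ := hf P Q i (p ≫ e.hom) q hP hQ hi ((isEmbedding_comp_iso p e).2 hp) hq
    (by rw [Category.assoc, h])
  refine ⟨d ≫ e.inv, ?_, ?_⟩
  · rw [← Category.assoc, hd, Category.assoc, e.hom_inv_id, Category.comp_id]
  · rw [Category.assoc, e.inv_hom_id_assoc, hd']

variable (J : G.Coalgebra ⥤ H.Coalgebra) [J.IsEquivalence]
  (he : ∀ {X Y : G.Coalgebra} (f : X ⟶ Y), IsEmbedding emb f ↔ IsEmbedding emb' (J.map f))
  (hp : ∀ X, path X ↔ path' (J.obj X))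
  (hi : ∀ {X Y : H.Coalgebra}, (X ≅ Y) → path' X → path' Y)

-- A test path for `J.map f` is isomorphic to one in the image of `J`; fullness pulls back its
-- morphism to `J.obj X`, and isomorphisms affect neither paths nor embeddings.
include he hp hi in
theorem isPathwiseEmbedding_map_iff {X Y : G.Coalgebra} (f : X ⟶ Y) :
    IsPathwiseEmbedding emb path f ↔ IsPathwiseEmbedding emb' path' (J.map f) := by
  constructor
  · intro hf P p hP hpe
    let e := J.objObjPreimageIso P
    have h := hf (J.objPreimage P) (J.preimage (e.hom ≫ p)) ((hp _).2 (hi e.symm hP))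
      ((he _).2 (by rw [J.map_preimage]; exact (isEmbedding_iso_comp e p).2 hpe))
    rw [he, J.map_comp, J.map_preimage, Category.assoc] at h
    exact (isEmbedding_iso_comp e _).1 h
  · intro hf P p hP hpe
    rw [he, J.map_comp]
    exact hf _ _ ((hp _).1 hP) ((he _).1 hpe)

include he hp hi in
theorem isOpenMorphism_map_iff {X Y : G.Coalgebra} (f : X ⟶ Y) :
    IsOpenMorphism emb path f ↔ IsOpenMorphism emb' path' (J.map f) := by
  constructor
  · intro hf P Q i p q hP hQ hie hpe hqe h
    let e := J.objObjPreimageIso P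
    let e' := J.objObjPreimageIso Q
    obtain ⟨d, hd, hd'⟩ := hf (J.objPreimage P) (J.objPreimage Q)
      (J.preimage (e.hom ≫ i ≫ e'.inv)) (J.preimage (e.hom ≫ p)) (J.preimage (e'.hom ≫ q))
      ((hp _).2 (hi e.symm hP)) ((hp _).2 (hi e'.symm hQ))
      ((he _).2 (by
        rw [J.map_preimage]
        exact (isEmbedding_iso_comp e _).2 ((isEmbedding_comp_iso i e'.symm).2 hie)))
      ((he _).2 (by rw [J.map_preimage]; exact (isEmbedding_iso_comp e p).2 hpe))
      ((he _).2 (by rw [J.map_preimage]; exact (isEmbedding_iso_comp e' q).2 hqe))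
      (J.map_injective (by
        rw [J.map_comp, J.map_comp, J.map_preimage, J.map_preimage, J.map_preimage]
        simp only [Category.assoc, e'.inv_hom_id_assoc, h]))
    refine ⟨e'.inv ≫ J.map d, ?_, ?_⟩
    · have := congrArg J.map hd
      rw [J.map_comp, J.map_preimage, J.map_preimage] at this
      rw [← cancel_epi e.hom, ← this]
      simp only [Category.assoc]
    · have := congrArg J.map hd'
      rw [J.map_comp, J.map_preimage] at this
      rw [Category.assoc, this, e'.inv_hom_id_assoc]
  · intro hf P Q i p q hP hQ hie hpe hqe h
    obtain ⟨d, hd, hd'⟩ := hf (J.obj P) (J.obj Q) (J.map i) (J.map p) (J.map q) ((hp _).1 hP)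
      ((hp _).1 hQ) ((he _).1 hie) ((he _).1 hpe) ((he _).1 hqe)
      (by rw [← J.map_comp, h, J.map_comp])
    refine ⟨J.preimage d, J.map_injective ?_, J.map_injective ?_⟩
    · rw [J.map_comp, J.map_preimage, hd]
    · rw [J.map_comp, J.map_preimage, hd']

include he hp hi in
/-- Bisimilarity transfers along equivalences of categories of coalgebras. -/
theorem coalgBisimilar_map_iff (X Y : G.Coalgebra) :
    CoalgBisimilar emb path X Y ↔ CoalgBisimilar emb' path' (J.obj X) (J.obj Y) := by
  constructor
  · rintro ⟨R, f, g, ⟨h1, h2⟩, h3, h4⟩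
    exact ⟨J.obj R, J.map f, J.map g,
      ⟨(isPathwiseEmbedding_map_iff J he hp hi f).1 h1, (isOpenMorphism_map_iff J he hp hi f).1 h2⟩,
      (isPathwiseEmbedding_map_iff J he hp hi g).1 h3, (isOpenMorphism_map_iff J he hp hi g).1 h4⟩
  · rintro ⟨R, f, g, ⟨h1, h2⟩, h3, h4⟩
    let e := J.objObjPreimageIso R
    refine ⟨J.objPreimage R, J.preimage (e.hom ≫ f), J.preimage (e.hom ≫ g), ⟨?_, ?_⟩, ?_, ?_⟩
    · rw [isPathwiseEmbedding_map_iff J he hp hi, J.map_preimage]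
      exact h1.iso_comp e
    · rw [isOpenMorphism_map_iff J he hp hi, J.map_preimage]
      exact h2.iso_comp e
    · rw [isPathwiseEmbedding_map_iff J he hp hi, J.map_preimage]
      exact h3.iso_comp e
    · rw [isOpenMorphism_map_iff J he hp hi, J.map_preimage]
      exact h4.iso_comp e

end Transfer

/-! ### Invariance of embeddings and paths under isomorphism -/

section IsoInvariance

variable {S : Type} {σ : MSig.{u} S} {k : ℕ}

theorem MStruct.embeddings_of_iso {A B : MStruct σ} (e : A ≅ B) :
    MStruct.embeddings σ e.hom := by
  have h : ∀ s x, MStruct.fn e.inv s (MStruct.fn e.hom s x) = x := fun s x =>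
    congrArg (fun f => MStruct.fn f s x) e.hom_inv_id
  refine ⟨fun s x y hxy => ?_, fun R x hx => ?_⟩
  · rw [← h s x, ← h s y]
    exact congrArg (MStruct.fn e.inv s) hxy
  · have := e.inv.map_rel R _ hx
    have e' : (fun i => MStruct.fn e.inv _ (MStruct.fn e.hom _ (x i))) = x := funext fun i => h _ _
    rwa [← e']

theorem MStruct.embeddings_comp {A B D : MStruct σ} {f : A ⟶ B} {g : B ⟶ D}
    (hf : MStruct.embeddings σ f) (hg : MStruct.embeddings σ g) :
    MStruct.embeddings σ (f ≫ g) :=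
  ⟨fun s => (hg.1 s).comp (hf.1 s), fun R x h => hf.2 R x (hg.2 R _ h)⟩

instance : (MStruct.embeddings σ).RespectsIso :=
  MorphismProperty.RespectsIso.mk _
    (fun e _ hf => MStruct.embeddings_comp (MStruct.embeddings_of_iso e) hf)
    (fun e _ hf => MStruct.embeddings_comp hf (MStruct.embeddings_of_iso e))

theorem efPath_of_iso {X Y : (EF σ k).Coalgebra} (e : X ≅ Y) (hX : EFPath σ k X) :
    EFPath σ k Y := by
  have h : ∀ s y, MStruct.fn e.hom.f s (MStruct.fn e.inv.f s y) = y := fun s y =>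
    congrArg (fun f : Y ⟶ Y => MStruct.fn f.f s y) e.inv_hom_id
  refine efPath_of_compat ?_ fun s t x y => ?_
  · have := hX.1
    refine Finite.of_injective (β := Σ s, ncLetters X.A s)
      (fun y => ⟨y.1, MStruct.fn e.inv.f y.1 y.2.1, ?_⟩) ?_
    · obtain ⟨w, hw⟩ := exists_branch Y y.2
      exact (hw.map e.inv).nonConst
    · rintro ⟨s, x⟩ ⟨t, y⟩ hxy
      obtain ⟨rfl, hxy⟩ := Sigma.mk.inj hxy
      have := congrArg Subtype.val (eq_of_heq hxy)
      have := congrArg (MStruct.fn e.hom.f s) this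
      dsimp only at this
      rw [h, h] at this
      rw [Subtype.ext this]
  · have := (hX.compat (MStruct.fn e.inv.f s x) (MStruct.fn e.inv.f t y)).of_map e.hom
    rwa [h, h] at this

end IsoInvariance

/-! ### Equivalence of the coalgebras of `𝔼_k^nc` and `𝔼_k` -/

section NoConstants

variable {S : Type} {σ : MSig.{u} S} {k : ℕ}

/-- The inclusion of words without constant letters into words. -/
def forgetNC (A : MStruct σ) (s : S) :
    σ.Const s ⊕ BWord (ncLetters A) k s → σ.Const s ⊕ BWord A.carrier k s :=
  Sum.map id fun w => ⟨w.1.map (fun _ a => a.1), (Word.length_map _ _).trans_le w.2⟩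

theorem forgetNC_injective (A : MStruct σ) (s : S) :
    Function.Injective (forgetNC (k := k) A s) := by
  refine Function.Injective.sumMap Function.injective_id fun w v h => Subtype.ext ?_
  exact Word.map_injective (fun s => Subtype.val_injective) _ _ (congrArg Subtype.val h)

theorem eval_forgetNC (A : MStruct σ) (s : S) (x : σ.Const s ⊕ BWord (ncLetters A) k s) :
    wordEval A (fun _ a => a) k s (forgetNC A s x) = wordEval A (fun _ a => a.1) k s x := by
  rcases x with c | w
  · rfl
  · exact Word.last_map (fun _ a => a.1) w.1

theorem compatible_forgetNC {A : MStruct σ} {s t : S} (x : σ.Const s ⊕ BWord (ncLetters A) k s)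
    (y : σ.Const t ⊕ BWord (ncLetters A) k t) :
    Compatible (forgetNC A s x) (forgetNC A t y) ↔ Compatible x y := by
  rcases x with c | w <;> rcases y with d | v
  · exact Iff.rfl
  · exact Iff.rfl
  · exact Iff.rfl
  · exact ⟨fun h => h.imp (.of_map fun _ => Subtype.val_injective)
      (.of_map fun _ => Subtype.val_injective), fun h => h.imp (.map _) (.map _)⟩

/-- The structure map of a coalgebra for `𝔼_k^nc`. -/
def ncCoalgMap (X : (EFnc σ k).Coalgebra) (s : S) (x : X.A.obj.carrier s) :
    σ.Const s ⊕ BWord (ncLetters X.A.obj) k s :=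
  MStruct.Hom.toFun X.a.hom s x

/-- The action of a morphism on non-constant elements. -/
def ncMap {A B : MStructNC σ} (f : A ⟶ B) (s : S) (a : ncLetters A.obj s) : ncLetters B.obj s :=
  ⟨MStruct.fn f.hom s a.1, f.property s a.1 a.2⟩

theorem fn_EFnc_map {A B : MStructNC σ} (f : A ⟶ B) (s : S)
    (x : σ.Const s ⊕ BWord (ncLetters A.obj) k s) :
    MStruct.fn ((EFnc σ k).map f).hom s x =
      Sum.map id (fun w : BWord (ncLetters A.obj) k s =>
        (⟨w.1.map (ncMap f), (Word.length_map _ _).trans_le w.2⟩ :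
          BWord (ncLetters B.obj) k s)) x := by
  rcases x with c | w
  · rfl
  · exact congrArg Sum.inr (Subtype.ext (Word.coext_last_comp (ncMap f) w.1 w.2))

theorem ncHom_ext {A B : MStructNC σ} {f g : A ⟶ B}
    (h : ∀ s x, MStruct.fn f.hom s x = MStruct.fn g.hom s x) : f = g :=
  WideSubcategory.hom_ext _ (MStruct.hom_ext h)

theorem eval_ncCoalgMap (X : (EFnc σ k).Coalgebra) {s : S} (x : X.A.obj.carrier s) :
    wordEval X.A.obj (fun _ a => a.1) k s (ncCoalgMap X s x) = x :=
  congrArg (fun f : X.A ⟶ X.A => MStruct.fn f.hom s x) X.counit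

theorem ncCoalgMap_of_isPrefix {X : (EFnc σ k).Coalgebra} {s t : S} {x : X.A.obj.carrier s}
    {w : BWord (ncLetters X.A.obj) k s} (h : ncCoalgMap X s x = Sum.inr w)
    {v : Word (ncLetters X.A.obj) t} (hv : v.IsPrefix w.1) :
    ncCoalgMap X t v.last.1 = Sum.inr ⟨v, hv.length_le.trans w.2⟩ := by
  have e : MStruct.fn ((EFnc σ k).δ.app X.A).hom s (ncCoalgMap X s x) =
      MStruct.fn ((EFnc σ k).map X.a).hom s (ncCoalgMap X s x) :=
    congrArg (fun f : X.A ⟶ (EFnc σ k).obj ((EFnc σ k).obj X.A) => MStruct.fn f.hom s x) X.coassoc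
  rw [h, fn_EFnc_map] at e
  have e' := congrArg Subtype.val (Sum.inr_injective e)
  have := (Word.coext_eq_map_iff _ _ _ _).1 e' t v hv
  exact (congrArg Subtype.val this).symm

/-- A coalgebra for `𝔼_k^nc` as a coalgebra for `𝔼_k`. -/
def forgetNCObj (X : (EFnc σ k).Coalgebra) : (EF σ k).Coalgebra :=
  mkCoalg X.A.obj (fun s x => forgetNC X.A.obj s (ncCoalgMap X s x))
    (fun s c => congrArg (forgetNC X.A.obj s) (X.a.hom.map_const s c))
    (fun s x => (eval_forgetNC _ _ _).trans (eval_ncCoalgMap X x))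
    (fun s x w hw t v hv => by
      rcases h : ncCoalgMap X s x with c | w'
      · rw [h] at hw
        cases hw
      · rw [h] at hw
        obtain rfl := Sum.inr_injective hw
        obtain ⟨v', hv', rfl⟩ := Word.exists_of_isPrefix_map _ _ hv
        rw [Word.last_map, ncCoalgMap_of_isPrefix h hv']
        rfl)
    (fun R x h i j => (compatible_forgetNC _ _).2 ((X.a.hom.map_rel R x h).1 i j))

theorem coalgMap_forgetNCObj (X : (EFnc σ k).Coalgebra) (s : S) (x : X.A.obj.carrier s) :
    coalgMap (forgetNCObj X) s x = forgetNC X.A.obj s (ncCoalgMap X s x) := rfl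

theorem ncCoalgMap_hom {X Y : (EFnc σ k).Coalgebra} (f : X ⟶ Y) {s : S}
    (x : X.A.obj.carrier s) :
    ncCoalgMap Y s (MStruct.fn f.f.hom s x) =
      Sum.map id (fun w : BWord (ncLetters X.A.obj) k s =>
        (⟨w.1.map (ncMap f.f), (Word.length_map _ _).trans_le w.2⟩ :
          BWord (ncLetters Y.A.obj) k s)) (ncCoalgMap X s x) := by
  rw [← fn_EFnc_map]
  exact (congrArg (fun f : X.A ⟶ (EFnc σ k).obj Y.A => MStruct.fn f.hom s x) f.h).symm

theorem branch_forgetNCObj {X : (EFnc σ k).Coalgebra} {s : S} {x : X.A.obj.carrier s}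
    {w : Word X.A.obj.carrier s} : Branch (forgetNCObj X) x w ↔
      ∃ v, ncCoalgMap X s x = Sum.inr v ∧ v.1.map (fun _ a => a.1) = w := by
  constructor
  · rintro ⟨hw, h⟩
    rw [coalgMap_forgetNCObj] at h
    rcases h' : ncCoalgMap X s x with c | v
    · rw [h'] at h
      cases h
    · rw [h'] at h
      exact ⟨v, rfl, congrArg Subtype.val (Sum.inr_injective h)⟩
  · rintro ⟨v, h, rfl⟩
    refine ⟨(Word.length_map _ _).trans_le v.2, ?_⟩
    rw [coalgMap_forgetNCObj, h]
    rfl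

/-- Coalgebras for `𝔼_k^nc` as coalgebras for `𝔼_k`. -/
def forgetNCFunctor (σ : MSig.{u} S) (k : ℕ) : (EFnc σ k).Coalgebra ⥤ (EF σ k).Coalgebra where
  obj := forgetNCObj
  map {X Y} f := mkHom (X := forgetNCObj X) (Y := forgetNCObj Y) f.f.hom fun s x w hw => by
    obtain ⟨v, hv, rfl⟩ := branch_forgetNCObj.1 hw
    refine branch_forgetNCObj.2 ⟨_, (ncCoalgMap_hom f x).trans (by rw [hv]; rfl), ?_⟩
    exact (Word.map_map _ _ _).trans (Word.map_map (fun s (a : ncLetters X.A.obj s) => a.1) (MStruct.fn f.f.hom) v.1).symm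
  map_id _ := rfl
  map_comp _ _ := rfl

instance : (forgetNCFunctor σ k).Faithful where
  map_injective h := Comonad.Coalgebra.Hom.ext
    (WideSubcategory.hom_ext _ (congrArg Comonad.Coalgebra.Hom.f h))

/-- In a coalgebra the elements with a word are exactly the non-constant ones, and coalgebra
morphisms carry words to words; hence they send non-constant elements to non-constant elements. -/
instance : (forgetNCFunctor σ k).Full where
  map_surjective {X Y} g := by
    let f : X.A ⟶ Y.A := ⟨g.f, fun s a ha => by
      obtain ⟨w, hw⟩ := exists_branch (forgetNCObj X) (⟨a, ha⟩ : ncLetters X.A.obj s)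
      exact (hw.map g).nonConst⟩
    refine ⟨⟨f, ncHom_ext fun s x => ?_⟩, rfl⟩
    change MStruct.fn ((EFnc σ k).map f).hom s (ncCoalgMap X s x) =
      ncCoalgMap Y s (MStruct.fn g.f s x)
    apply forgetNC_injective
    have e := coalgMap_hom g (s := s) x
    change forgetNC Y.A.obj s (ncCoalgMap Y s (MStruct.fn g.f s x)) = _ at e
    refine Eq.trans ?_ e.symm
    rw [fn_EFnc_map]
    change _ = Sum.map id _ (forgetNC X.A.obj s (ncCoalgMap X s x))
    rcases ncCoalgMap X s x with c | w
    · rfl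
    · refine congrArg Sum.inr (Subtype.ext ?_)
      exact (Word.map_map _ _ _).trans (Word.map_map (fun s (a : ncLetters X.A.obj s) => a.1) (MStruct.fn g.f) w.1).symm

/-- Each letter of the word of `x` is the last letter of a prefix and so has a word itself; it is
therefore non-constant. -/
theorem exists_forgetNC_eq (X : (EF σ k).Coalgebra) (s : S) (x : X.A.carrier s) :
    ∃ z, forgetNC X.A s z = coalgMap X s x := by
  rcases h : coalgMap X s x with c | w
  · exact ⟨Sum.inl c, rfl⟩
  · have hb : Branch X x w.1 := ⟨w.2, h⟩
    obtain ⟨w', e⟩ := Word.exists_lift (fun s => X.A.NonConst (s := s)) w.1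
      fun t v hv => (hb.of_isPrefix hv).nonConst
    exact ⟨Sum.inr ⟨w', ((Word.length_map (fun _ a => a.1) w').symm.trans
      (congrArg Word.length e)).trans_le w.2⟩, congrArg Sum.inr (Subtype.ext e)⟩

instance : (forgetNCFunctor σ k).EssSurj where
  mem_essImage X := by
    choose α hα using exists_forgetNC_eq X
    have hev : ∀ s x, wordEval X.A (fun _ a => a.1) k s (α s x) = x := fun s x => by
      rw [← eval_forgetNC, hα, eval_coalgMap]
    let a' : MStruct.Hom X.A (ncWordStruct X.A k) :=
      ⟨α, fun s c => forgetNC_injective _ _ ((hα _ _).trans (coalgMap_const X c)),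
        fun R x h => ⟨fun i j => (compatible_forgetNC _ _).1 (by
          rw [hα, hα]
          exact (X.a.map_rel R x h).1 i j), by simpa only [hev] using h⟩⟩
    let a : (⟨X.A⟩ : MStructNC σ) ⟶ (EFnc σ k).obj ⟨X.A⟩ := ⟨a', fun s x hx c h => by
      obtain ⟨w, hw, h'⟩ := exists_branch X ⟨x, hx⟩
      have := hα s x
      change Sum.inl c = α s x at h
      rw [← h, h'] at this
      cases this⟩
    let X' : (EFnc σ k).Coalgebra :=
      { A := ⟨X.A⟩
        a := a
        counit := ncHom_ext hev
        coassoc := ncHom_ext fun s x => by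
          change MStruct.fn ((EFnc σ k).δ.app ⟨X.A⟩).hom s (α s x) =
            MStruct.fn ((EFnc σ k).map a).hom s (α s x)
          rcases h : α s x with c | w
          · rfl
          · rw [fn_EFnc_map]
            refine congrArg Sum.inr (Subtype.ext ?_)
            refine (Word.coext_eq_map_iff _ _ _ w.2).2 fun t v hv => Subtype.ext ?_
            change Sum.inr _ = α t v.last.1
            apply forgetNC_injective
            have hx := hα s x
            rw [h] at hx
            have hb : Branch X x (w.1.map fun _ a => a.1) := ⟨_, hx.symm⟩
            obtain ⟨_, h'⟩ := hb.of_isPrefix (hv.map _)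
            rw [hα]
            exact h'.symm.trans (congrArg (coalgMap X t) (Word.last_map _ v)) }
    have hb : ∀ s (x : X.A.carrier s) w, Branch (forgetNCObj X') x w ↔ Branch X x w := by
      intro s x w
      have : coalgMap (forgetNCObj X') s x = coalgMap X s x := hα s x
      exact exists_congr fun h => by rw [this]; exact Iff.rfl
    refine ⟨X', ⟨⟨mkHom (X := forgetNCObj X') (Y := X) (𝟙 X.A) fun s x w h => ?_,
      mkHom (X := X) (Y := forgetNCObj X') (𝟙 X.A) fun s x w h => ?_, rfl, rfl⟩⟩⟩
    · have e : w.map (MStruct.fn (𝟙 X.A)) = w := Word.map_id w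
      exact e.symm ▸ (hb s x w).1 h
    · have e : w.map (MStruct.fn (𝟙 X.A)) = w := Word.map_id w
      exact e.symm ▸ (hb s x w).2 h

instance : (forgetNCFunctor σ k).IsEquivalence where

theorem efncPath_iff (X : (EFnc σ k).Coalgebra) :
    EFncPath σ k X ↔ EFPath σ k ((forgetNCFunctor σ k).obj X) := by
  have h : coalgOrder (k := k) X.A.obj (fun s => MStruct.Hom.toFun X.a.hom s) =
      coalgOrder (k := k) X.A.obj (fun s => MStruct.Hom.toFun (forgetNCObj X).a s) := by
    funext x y
    refine propext ⟨?_, ?_⟩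
    · rintro ⟨w, v, hw, hv, h⟩
      exact ⟨_, _, congrArg (forgetNC X.A.obj _) hw, congrArg (forgetNC X.A.obj _) hv, h.map _⟩
    · rintro ⟨w, v, hw, hv, h⟩
      obtain ⟨w', hw', e⟩ := branch_forgetNCObj.1 ⟨w.2, hw⟩
      obtain ⟨v', hv', e'⟩ := branch_forgetNCObj.1 ⟨v.2, hv⟩
      rw [← e, ← e'] at h
      exact ⟨w', v', hw', hv', h.of_map fun _ => Subtype.val_injective⟩
  exact and_congr Iff.rfl (by rw [h]; exact Iff.rfl)

/-- In general the equivalence does not take cofree coalgebras to cofree ones, since constant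
letters are missing. The result is therefore about two coalgebras, not an instance of `EFBisimilar`.
-/
theorem efncBisimilar_iff (A B : MStructNC σ) :
    EFncBisimilar k A B ↔ CoalgBisimilar (MStruct.embeddings σ) (EFPath σ k)
      ((forgetNCFunctor σ k).obj ((EFnc σ k).cofree.obj A))
      ((forgetNCFunctor σ k).obj ((EFnc σ k).cofree.obj B)) :=
  coalgBisimilar_map_iff (emb := ncEmbeddings σ) (path := EFncPath σ k) (forgetNCFunctor σ k)
    (fun _ => Iff.rfl) efncPath_iff efPath_of_iso _ _

end NoConstants

/-! ### Coalgebras of words, covering both kinds of cofree coalgebra -/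

section WordCoalg

variable {S : Type} {σ : MSig.{u} S} {k : ℕ}

theorem coalg_ext {X Y : (EF σ k).Coalgebra} (hA : X.A = Y.A) (ha : X.a ≍ Y.a) : X = Y := by
  obtain ⟨A, a, _, _⟩ := X
  obtain ⟨B, b, _, _⟩ := Y
  dsimp only at hA
  subst hA
  obtain rfl := eq_of_heq ha
  rfl

/-- The coalgebra on a structure of words whose structure map lists the prefixes. -/
def wordCoalg (A : MStruct σ) (L : S → Type u) (ι : ∀ s, L s → A.carrier s) (k : ℕ) :
    (EF σ k).Coalgebra :=
  mkCoalg (wordStruct A L ι k)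
    (fun s => Sum.map id (BWord.coext (M := fun s => σ.Const s ⊕ BWord L k s)
      (fun _ v => Sum.inr v) s))
    (fun _ _ => rfl)
    (fun s x => by
      rcases x with c | w
      · rfl
      · exact Word.last_coext _ w.1 w.2)
    (fun s x w hw t v hv => by
      rcases x with c | w'
      · cases hw
      · obtain rfl := Sum.inr_injective hw
        obtain ⟨v', hv', rfl⟩ := Word.exists_of_isPrefix_coext _ _ _ hv
        rw [Word.last_coext]
        rfl)
    (fun R x h i j => (h.1 i j).coext _)

/-- The carriers agree by definition, and forgetting that prefixes are non-constant commutes with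
listing them. -/
theorem forgetNC_cofree_eq_wordCoalg (A : MStructNC σ) :
    (forgetNCFunctor σ k).obj ((EFnc σ k).cofree.obj A) =
      wordCoalg A.obj (ncLetters A.obj) (fun _ a => a.1) k := by
  refine coalg_ext rfl (heq_of_eq (MStruct.hom_ext fun s x => ?_))
  rcases x with c | w
  · rfl
  · exact congrArg Sum.inr (Subtype.ext (Word.map_coext _ _ _ _))

variable {A : MStruct σ} {L : S → Type u} {ι : ∀ s, L s → A.carrier s}

/-- The list of the prefixes of a word, as letters of a word. -/
def prefixWord (σ : MSig.{u} S) {s : S} (w : Word L s) (h : w.length ≤ k) :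
    Word (fun s => σ.Const s ⊕ BWord L k s) s :=
  Word.coext (fun _ v => Sum.inr v) w h

theorem last_prefixWord {s : S} (w : Word L s) (h : w.length ≤ k) :
    (prefixWord σ w h).last = Sum.inr ⟨w, h⟩ :=
  Word.last_coext _ w h

theorem branch_wordCoalg {s : S} {x : σ.Const s ⊕ BWord L k s}
    {u : Word (fun s => σ.Const s ⊕ BWord L k s) s} :
    Branch (wordCoalg A L ι k) x u ↔
      ∃ w : BWord L k s, x = Sum.inr w ∧ u = prefixWord σ w.1 w.2 := by
  constructor
  · rintro ⟨hu, h⟩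
    rcases x with c | w
    · cases h
    · exact ⟨w, rfl, (congrArg Subtype.val (Sum.inr_injective h)).symm⟩
  · rintro ⟨w, rfl, rfl⟩
    exact ⟨(Word.length_coext _ _ _).trans_le w.2, rfl⟩

theorem isPrefix_prefixWord {s t : S} {w : Word L s} {v : Word L t} {hw : w.length ≤ k}
    {hv : v.length ≤ k} : (prefixWord σ w hw).IsPrefix (prefixWord σ v hv) ↔ w.IsPrefix v := by
  refine ⟨fun h => ?_, fun h => h.coext _ _ _⟩
  obtain ⟨v', hv', e⟩ := Word.exists_of_isPrefix_coext _ _ _ h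
  have := congrArg Word.last e
  rw [last_prefixWord, Word.last_coext] at this
  obtain rfl := congrArg Subtype.val (Sum.inr_injective this)
  exact hv'

theorem compat_wordCoalg {s t : S} {x : σ.Const s ⊕ BWord L k s} {y : σ.Const t ⊕ BWord L k t} :
    Compat (wordCoalg A L ι k) (s := s) (t := t) x y ↔ Compatible x y := by
  constructor
  · intro h
    rcases x with c | w <;> rcases y with d | v
    · trivial
    · trivial
    · trivial
    · exact (h _ _ (branch_wordCoalg.2 ⟨w, rfl, rfl⟩) (branch_wordCoalg.2 ⟨v, rfl, rfl⟩)).imp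
        isPrefix_prefixWord.1 isPrefix_prefixWord.1
  · intro h w v hw hv
    obtain ⟨w, rfl, rfl⟩ := branch_wordCoalg.1 hw
    obtain ⟨v, rfl, rfl⟩ := branch_wordCoalg.1 hv
    exact h.imp isPrefix_prefixWord.2 isPrefix_prefixWord.2

/-- The position of a word coalgebra given by a possibly empty word. -/
def prefixPos (σ : MSig.{u} S) : ∀ o : Word.Opt L, Word.olength o ≤ k →
    Word.Opt (fun s => σ.Const s ⊕ BWord L k s)
  | none, _ => none
  | some w, h => some ⟨w.1, prefixWord σ w.2 h⟩

theorem prefixPos_injective {o o' : Word.Opt L} {h : Word.olength o ≤ k}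
    {h' : Word.olength o' ≤ k} (e : prefixPos σ o h = prefixPos σ o' h') : o = o' := by
  rcases o with _ | ⟨s, w⟩ <;> rcases o' with _ | ⟨t, v⟩
  · rfl
  · cases e
  · cases e
  · obtain ⟨rfl, e⟩ := Sigma.mk.inj (Option.some_injective _ e)
    have := (last_prefixWord w h).symm.trans
      ((congrArg Word.last (eq_of_heq e)).trans (last_prefixWord _ h'))
    exact congrArg (fun w : Word L s => (some ⟨s, w⟩ : Word.Opt L))
      (congrArg Subtype.val (Sum.inr_injective this))

theorem exists_prefixPos {p : Word.Opt (fun s => σ.Const s ⊕ BWord L k s)}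
    (hp : IsPosition (wordCoalg A L ι k) p) : ∃ (o : Word.Opt L) (h : _), p = prefixPos σ o h := by
  rcases p with _ | ⟨s, w⟩
  · exact ⟨none, Nat.zero_le _, rfl⟩
  · obtain ⟨w', h, e⟩ := branch_wordCoalg.1 (hp _ rfl)
    exact ⟨some ⟨s, w'.1⟩, w'.2, by dsimp only at e; rw [e]; rfl⟩

theorem length_append_le {o : Word.Opt L} (h : Word.olength o < k) {s : S} (a : L s) :
    (Word.append o a).length ≤ k := by
  rw [Word.length_append]
  exact h

theorem prefixWord_append {o : Word.Opt L} (h : Word.olength o ≤ k) {s : S} (a : L s)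
    (h' : (Word.append o a).length ≤ k) :
    prefixWord σ (Word.append o a) h' =
      Word.append (prefixPos σ o h) (Sum.inr ⟨Word.append o a, h'⟩) := by
  rcases o with _ | w
  · rfl
  · rfl

/-- The word of a word is the list of its prefixes, which determines it. So to extend a position of
the coalgebra by one step is to append one letter from `L`, as far as the length bound allows. -/
theorem branch_append_wordCoalg {o : Word.Opt L} (h : Word.olength o ≤ k) {s : S}
    {y : σ.Const s ⊕ BWord L k s} :
    Branch (wordCoalg A L ι k) y (Word.append (prefixPos σ o h) y) ↔
      ∃ (a : L s) (h' : _), y = Sum.inr ⟨Word.append o a, h'⟩ := by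
  constructor
  · intro hy
    obtain ⟨w, rfl, e⟩ := branch_wordCoalg.1 hy
    obtain ⟨w, hw⟩ := w
    obtain ⟨o', e'⟩ := Word.exists_eq_append w
    refine ⟨w.last, ?_⟩
    revert hw
    generalize w.last = a at e'
    subst e'
    intro hw _ e
    have ho : Word.olength o' ≤ k := by
      rw [Word.length_append] at hw
      omega
    rw [prefixWord_append ho] at e
    obtain rfl := prefixPos_injective (Word.append_injective e).1
    exact ⟨hw, rfl⟩
  · rintro ⟨a, h', rfl⟩
    exact branch_wordCoalg.2 ⟨_, rfl, (prefixWord_append h a h').symm⟩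

theorem omap_prefixPos {M : S → Type u} (φ : ∀ s, L s → M s) {o : Word.Opt L}
    (h : Word.olength o ≤ k) :
    Word.omap (fun s => Sum.map id (fun w : BWord L k s =>
      (⟨w.1.map φ, (Word.length_map _ _).trans_le w.2⟩ : BWord M k s))) (prefixPos σ o h) =
      prefixPos σ (Word.omap φ o) ((Word.olength_omap _ _).trans_le h) := by
  have key : ∀ {s : S} (w : Word L s) (h : w.length ≤ k) (h' : (w.map φ).length ≤ k),
      (prefixWord σ w h).map (fun s => Sum.map id (fun w : BWord L k s =>
      (⟨w.1.map φ, (Word.length_map _ _).trans_le w.2⟩ : BWord M k s))) =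
      prefixWord σ (w.map φ) h' := by
    intro s w
    induction w with
    | single a => exact fun _ _ => rfl
    | snoc w a ih =>
      intro h h'
      exact congrArg (fun v => Word.snoc v _) (ih ((Nat.le_succ _).trans h)
        ((Nat.le_succ _).trans h'))
  rcases o with _ | w
  · rfl
  · exact congrArg (fun v => (some ⟨w.1, v⟩ : Word.Opt _)) (key w.2 _ _)

end WordCoalg

/-! ### Bisimilarity of word coalgebras and the Ehrenfeucht–Fraïssé game -/

section Game

variable {S : Type} {σ : MSig.{u} S} {A B : MStruct σ} {L M : S → Type u}

/-- A set of pairs of elements is a partial isomorphism, as far as the relations are concerned. -/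
def PartialIso (P : Set (Σ s, A.carrier s × B.carrier s)) : Prop :=
  ∀ R (x : ∀ i, A.carrier (σ.sort R i)) (y : ∀ i, B.carrier (σ.sort R i)),
    (∀ i, ⟨_, x i, y i⟩ ∈ P) → (A.rel R x ↔ B.rel R y)

/-- Duplicator wins the `r`-round Ehrenfeucht–Fraïssé game from a position, where the players
choose elements from `L` and `M`. -/
def Game (ι : ∀ s, L s → A.carrier s) (κ : ∀ s, M s → B.carrier s) :
    ℕ → Set (Σ s, A.carrier s × B.carrier s) → Prop
  | 0, P => PartialIso P
  | r + 1, P => PartialIso P ∧ ∀ s,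
      (∀ a : L s, ∃ b : M s, Game ι κ r (insert ⟨s, ι s a, κ s b⟩ P)) ∧
      (∀ b : M s, ∃ a : L s, Game ι κ r (insert ⟨s, ι s a, κ s b⟩ P))

variable (A B) in
/-- The pairs of interpretations of the constants. -/
def constPairs : Set (Σ s, A.carrier s × B.carrier s) :=
  {p | ∃ c, A.const p.1 c = p.2.1 ∧ B.const p.1 c = p.2.2}

variable {ι : ∀ s, L s → A.carrier s} {κ : ∀ s, M s → B.carrier s}

theorem Game.partialIso {P : Set (Σ s, A.carrier s × B.carrier s)} :
    ∀ {r : ℕ}, Game ι κ r P → PartialIso P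
  | 0, h => h
  | _ + 1, h => h.1

/-- Fewer pairs are fewer constraints. Positions of the game thus need only be bounded by inclusion,
never computed exactly. -/
theorem Game.mono {r : ℕ} : ∀ {P Q : Set (Σ s, A.carrier s × B.carrier s)}, P ⊆ Q →
    Game ι κ r Q → Game ι κ r P := by
  induction r with
  | zero => exact fun hPQ h R x y hxy => h R x y fun i => hPQ (hxy i)
  | succ r ih =>
    refine fun hPQ h => ⟨fun R x y hxy => h.1 R x y fun i => hPQ (hxy i), fun s => ⟨?_, ?_⟩⟩
    · intro a
      obtain ⟨b, hb⟩ := (h.2 s).1 a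
      exact ⟨b, ih (Set.insert_subset_insert hPQ) hb⟩
    · intro b
      obtain ⟨a, ha⟩ := (h.2 s).2 b
      exact ⟨a, ih (Set.insert_subset_insert hPQ) ha⟩

variable {k : ℕ}

/-! ### From a span to a winning strategy -/

section OfSpan

variable {W : (EF σ k).Coalgebra} (f : W ⟶ wordCoalg A L ι k) (g : W ⟶ wordCoalg B M κ k)

/-- The pairs of elements given by the elements of a position of a span. -/
def spanPairs (o : Word.Opt W.A.carrier) : Set (Σ s, A.carrier s × B.carrier s) :=
  {p | ∃ x, OnPath o p.1 x ∧ wordEval A ι k p.1 (MStruct.fn f.f p.1 x) = p.2.1 ∧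
    wordEval B κ k p.1 (MStruct.fn g.f p.1 x) = p.2.2}

variable {f g}

theorem OnPath.compat {o : Word.Opt W.A.carrier} {s t : S} {x : W.A.carrier s}
    {y : W.A.carrier t} (hx : OnPath o s x) (hy : OnPath o t y) : Compat W x y :=
  fun _ _ hw hv => (hx.below hw).comparable (hy.below hv)

/-- A relation in `A` is reflected along one leg to the apex and preserved along the other leg into
`B`. -/
theorem rel_of_reflectsComparable (hf : ReflectsComparable f) {R : σ.Rel}
    {x : ∀ i, W.A.carrier (σ.sort R i)} (hx : ∀ i j, Compat W (x i) (x j))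
    (h : A.rel R fun i => wordEval A ι k _ (MStruct.fn f.f _ (x i))) :
    B.rel R fun i => wordEval B κ k _ (MStruct.fn g.f _ (x i)) :=
  (g.f.map_rel R x (hf R x hx
    ⟨fun i j => compat_wordCoalg.1 ((hx i j).of_map f), h⟩)).2

theorem partialIso_spanPairs (hf : ReflectsComparable f) (hg : ReflectsComparable g)
    (o : Word.Opt W.A.carrier) : PartialIso (spanPairs f g o) := by
  intro R x y hxy
  have hxy : ∀ i, ∃ z : W.A.carrier (σ.sort R i), OnPath o _ z ∧
      wordEval A ι k _ (MStruct.fn f.f _ z) = x i ∧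
      wordEval B κ k _ (MStruct.fn g.f _ z) = y i := hxy
  choose z hz hx hy using hxy
  obtain rfl : (fun i => wordEval A ι k _ (MStruct.fn f.f _ (z i))) = x := funext hx
  obtain rfl : (fun i => wordEval B κ k _ (MStruct.fn g.f _ (z i))) = y := funext hy
  exact ⟨rel_of_reflectsComparable hf fun i j => (hz i).compat (hz j),
    rel_of_reflectsComparable hg fun i j => (hz i).compat (hz j)⟩

/-- Spoiler's letter `a` extends the image of the position by one step, which is a word of length at
most `k` because of `hl`; the lifted step supplies the new element of the apex. -/
theorem exists_extension {o : Word.Opt W.A.carrier} (hf : LiftsExtensions f)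
    (ho : IsPosition W o) (hl : Word.olength o < k) {s : S} (a : L s) :
    ∃ x, Branch W x (Word.append o x) ∧ wordEval A ι k s (MStruct.fn f.f s x) = ι s a := by
  obtain ⟨u, hu, e⟩ := exists_prefixPos (ho.map f)
  have hl' : Word.olength u = Word.olength o := by
    have := congrArg Word.olength e
    rw [Word.olength_omap] at this
    rw [this]
    rcases u with _ | u
    · rfl
    · exact (Word.length_coext _ _ _).symm
  have h' := length_append_le (hl'.trans_lt hl) a
  obtain ⟨x, hx, hx'⟩ := hf o ho s (Sum.inr ⟨Word.append u a, h'⟩) (by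
    rw [e]
    exact (branch_append_wordCoalg hu).2 ⟨a, h', rfl⟩)
  refine ⟨x, hx, ?_⟩
  rw [hx']
  exact congrArg (ι s) (Word.last_append u a)

theorem exists_letter {X : (EF σ k).Coalgebra} (h : X ⟶ wordCoalg A L ι k) {s : S}
    {x : X.A.carrier s} {w : Word X.A.carrier s} (hx : Branch X x w) :
    ∃ a, wordEval A ι k s (MStruct.fn h.f s x) = ι s a := by
  obtain ⟨v, hv, -⟩ := branch_wordCoalg.1 (hx.map h)
  exact ⟨v.1.last, by rw [hv]; rfl⟩

theorem insert_subset_spanPairs {o : Word.Opt W.A.carrier} {s : S} {x : W.A.carrier s}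
    (hx : Branch W x (Word.append o x)) :
    insert ⟨s, wordEval A ι k s (MStruct.fn f.f s x), wordEval B κ k s (MStruct.fn g.f s x)⟩
      (spanPairs f g o) ⊆ spanPairs f g (some ⟨s, Word.append o x⟩) := by
  rintro p (rfl | ⟨y, hy, h⟩)
  · exact ⟨x, .inr ⟨_, hx, _, rfl, .refl _⟩, rfl, rfl⟩
  · exact ⟨y, hy.imp_right fun ⟨w, hw, hb⟩ => ⟨w, hw, _, rfl, hb.append x⟩, h⟩

theorem isPosition_append {o : Word.Opt W.A.carrier} {s : S} {x : W.A.carrier s}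
    (hx : Branch W x (Word.append o x)) : IsPosition W (some ⟨s, Word.append o x⟩) := by
  rintro _ ⟨⟩
  exact branch_last_of_append hx

/-- The strategy stays on a branch of the apex: a move is lifted along the leg on Spoiler's side,
and the answer is the last letter of the image along the other leg. The length bound guarantees room
for all remaining rounds. -/
theorem game_spanPairs (hf : ReflectsComparable f ∧ LiftsExtensions f)
    (hg : ReflectsComparable g ∧ LiftsExtensions g) :
    ∀ (r : ℕ) (o : Word.Opt W.A.carrier), IsPosition W o → Word.olength o + r ≤ k →
      Game ι κ r (spanPairs f g o)
  | 0, o, _, _ => partialIso_spanPairs hf.1 hg.1 o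
  | r + 1, o, ho, hl => by
    refine ⟨partialIso_spanPairs hf.1 hg.1 o, fun s => ⟨fun a => ?_, fun b => ?_⟩⟩
    · obtain ⟨x, hx, ha⟩ := exists_extension hf.2 ho (by omega) a
      obtain ⟨b, hb⟩ := exists_letter g hx
      refine ⟨b, ?_⟩
      rw [← ha, ← hb]
      refine (game_spanPairs hf hg r _ (isPosition_append hx) ?_).mono (insert_subset_spanPairs hx)
      have := Word.length_append o x
      simp only [Word.olength]
      omega
    · obtain ⟨x, hx, hb⟩ := exists_extension hg.2 ho (by omega) b
      obtain ⟨a, ha⟩ := exists_letter f hx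
      refine ⟨a, ?_⟩
      rw [← ha, ← hb]
      refine (game_spanPairs hf hg r _ (isPosition_append hx) ?_).mono (insert_subset_spanPairs hx)
      have := Word.length_append o x
      simp only [Word.olength]
      omega

theorem constPairs_subset_spanPairs (o : Word.Opt W.A.carrier) :
    constPairs A B ⊆ spanPairs f g o := by
  rintro p ⟨c, h1, h2⟩
  refine ⟨W.A.const p.1 c, onPath_const o p.1 c, ?_, ?_⟩
  · rw [MStruct.fn, MStruct.Hom.map_const]
    exact h1
  · rw [MStruct.fn, MStruct.Hom.map_const]
    exact h2

end OfSpan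

/-! ### From a winning strategy to a span -/

section ToSpan

/-- The pairs of elements that occur in a possibly empty word of pairs, and the pairs of
constants. -/
def wordPairs (ι : ∀ s, L s → A.carrier s) (κ : ∀ s, M s → B.carrier s)
    (o : Word.Opt fun s => L s × M s) : Set (Σ s, A.carrier s × B.carrier s) :=
  constPairs A B ∪ {p | ∃ v : Word (fun s => L s × M s) p.1, v.Below o ∧
    ι p.1 v.last.1 = p.2.1 ∧ κ p.1 v.last.2 = p.2.2}

/-- Duplicator wins from all non-empty prefixes of a play of the `k`-round game. -/
def Winning (ι : ∀ s, L s → A.carrier s) (κ : ∀ s, M s → B.carrier s) (k : ℕ)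
    (o : Word.Opt fun s => L s × M s) : Prop :=
  ∀ t (v : Word (fun s => L s × M s) t), v.Below o →
    Game ι κ (k - v.length) (wordPairs ι κ (some ⟨t, v⟩))

/-- `Winning` concerns non-empty prefixes only; the empty play is covered by `hk`. -/
theorem Winning.game (hk : Game ι κ k (constPairs A B)) {o : Word.Opt fun s => L s × M s}
    (h : Winning ι κ k o) : Game ι κ (k - Word.olength o) (wordPairs ι κ o) := by
  rcases o with _ | w
  · refine hk.mono ?_
    rintro p (hp | ⟨_, ⟨_, ⟨⟩, _⟩, _⟩)
    exact hp
  · exact h _ w.2 ⟨_, rfl, .refl _⟩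

theorem Winning.of_below {o : Word.Opt fun s => L s × M s} (h : Winning ι κ k o) {s : S}
    {w : Word (fun s => L s × M s) s} (hw : w.Below o) : Winning ι κ k (some ⟨s, w⟩) := by
  rintro t v ⟨_, ⟨⟩, hv⟩
  exact h t v (hw.of_isPrefix hv)

/-- Only the whole new play has to be checked, since its proper prefixes lie below `o`. The
hypothesis counts the pair just added as one more round spent. -/
theorem Winning.append {o : Word.Opt fun s => L s × M s} (h : Winning ι κ k o) {s : S}
    {a : L s} {b : M s}
    (hab : Game ι κ (k - (Word.olength o + 1)) (insert ⟨s, ι s a, κ s b⟩ (wordPairs ι κ o))) :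
    Winning ι κ k (some ⟨s, Word.append o ((a, b) : L s × M s)⟩) := by
  rintro t v ⟨_, ⟨⟩, hv⟩
  rcases Word.isPrefix_append hv with e | hv
  · cases e
    rw [Word.length_append]
    refine hab.mono ?_
    rintro p (hp | ⟨v, ⟨_, ⟨⟩, hv⟩, h1, h2⟩)
    · exact .inr (.inl hp)
    · rcases Word.isPrefix_append hv with e | hv
      · obtain ⟨s', a', b'⟩ := p
        cases e
        rw [Word.last_append] at h1 h2
        obtain rfl : ι s a = a' := h1
        obtain rfl : κ s b = b' := h2
        exact .inl rfl
      · exact .inr (.inr ⟨v, hv, h1, h2⟩)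
  · exact h t v hv

theorem Winning.forth (hk : Game ι κ k (constPairs A B)) {o : Word.Opt fun s => L s × M s}
    (h : Winning ι κ k o) (hl : Word.olength o < k) {s : S} (a : L s) :
    ∃ b : M s, Winning ι κ k (some ⟨s, Word.append o ((a, b) : L s × M s)⟩) := by
  have hg := h.game hk
  -- Here `hl` matters: the subtraction is not truncated, so a round is left to be played.
  rw [show k - Word.olength o = (k - (Word.olength o + 1)) + 1 by omega] at hg
  obtain ⟨b, hb⟩ := (hg.2 s).1 a
  exact ⟨b, h.append hb⟩

theorem Winning.back (hk : Game ι κ k (constPairs A B)) {o : Word.Opt fun s => L s × M s}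
    (h : Winning ι κ k o) (hl : Word.olength o < k) {s : S} (b : M s) :
    ∃ a : L s, Winning ι κ k (some ⟨s, Word.append o ((a, b) : L s × M s)⟩) := by
  have hg := h.game hk
  rw [show k - Word.olength o = (k - (Word.olength o + 1)) + 1 by omega] at hg
  obtain ⟨a, ha⟩ := (hg.2 s).2 b
  exact ⟨a, h.append ha⟩

/-- The constants and the winning plays. -/
def WinningElem (ι : ∀ s, L s → A.carrier s) (κ : ∀ s, M s → B.carrier s) (k : ℕ) (s : S)
    (x : σ.Const s ⊕ BWord (fun s => L s × M s) k s) : Prop :=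
  ∀ w, x = Sum.inr w → Winning ι κ k (some ⟨s, w.1⟩)

/-- The coalgebra of words of pairs, with the relations of the left structure. -/
abbrev pairCoalg (ι : ∀ s, L s → A.carrier s) (M : S → Type u) (k : ℕ) : (EF σ k).Coalgebra :=
  wordCoalg A (fun s => L s × M s) (fun s p => ι s p.1) k

theorem WinningElem.last (s : S) (x : σ.Const s ⊕ BWord (fun s => L s × M s) k s)
    (w : Word (fun s => σ.Const s ⊕ BWord (fun s => L s × M s) k s) s)
    (hx : WinningElem ι κ k s x) (hw : Branch (pairCoalg ι M k) x w) (t : S)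
    (v : Word (fun s => σ.Const s ⊕ BWord (fun s => L s × M s) k s) t) (hv : v.IsPrefix w) :
    WinningElem ι κ k t v.last := by
  obtain ⟨w, rfl, rfl⟩ := branch_wordCoalg.1 hw
  obtain ⟨v', hv', rfl⟩ := Word.exists_of_isPrefix_coext _ _ _ hv
  intro u hu
  rw [Word.last_coext] at hu
  obtain rfl := Sum.inr_injective hu
  exact (hx w rfl).of_below ⟨_, rfl, hv'⟩

/-- The coalgebra of winning plays. -/
noncomputable def playCoalg (ι : ∀ s, L s → A.carrier s) (κ : ∀ s, M s → B.carrier s) (k : ℕ) :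
    (EF σ k).Coalgebra :=
  subCoalg (pairCoalg ι M k) (WinningElem ι κ k) (fun _ _ _ h => by cases h) WinningElem.last

/-- The letterwise action of a family of maps on the elements of word structures. -/
def elemMap {N : S → Type u} (σ : MSig.{u} S) (φ : ∀ s, L s → N s) (s : S) :
    σ.Const s ⊕ BWord L k s → σ.Const s ⊕ BWord N k s :=
  Sum.map id fun w => ⟨w.1.map φ, (Word.length_map _ _).trans_le w.2⟩

theorem map_prefixWord {N : S → Type u} (φ : ∀ s, L s → N s) {s : S} (w : BWord L k s) :
    (prefixWord σ w.1 w.2).map (elemMap σ φ) =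
      prefixWord σ (w.1.map φ) ((Word.length_map _ _).trans_le w.2) := by
  have h := omap_prefixPos (σ := σ) φ (o := some ⟨s, w.1⟩) w.2
  exact eq_of_heq (Sigma.mk.inj (Option.some_injective _ h)).2

theorem branch_playCoalg {s : S} {x : (playCoalg ι κ k).A.carrier s}
    {w : Word (playCoalg ι κ k).A.carrier s} :
    Branch (playCoalg ι κ k) x w ↔ Branch (pairCoalg ι M k) x.1 (w.map fun _ a => a.1) :=
  branch_subCoalg _ _ _ _

theorem compat_playCoalg {s t : S} {x : (playCoalg ι κ k).A.carrier s}
    {y : (playCoalg ι κ k).A.carrier t} (h : Compat (playCoalg ι κ k) x y) :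
    Compatible x.1 y.1 :=
  compat_wordCoalg.1 (h.of_map (subIncl (pairCoalg ι M k) (WinningElem ι κ k)
    (fun _ _ _ h => by cases h) WinningElem.last))

theorem Compatible.elemMap {N : S → Type u} (φ : ∀ s, L s → N s) {s t : S}
    {x : σ.Const s ⊕ BWord L k s} {y : σ.Const t ⊕ BWord L k t} (h : Compatible x y) :
    Compatible (elemMap σ φ s x) (elemMap σ φ t y) := by
  rcases x with c | w <;> rcases y with d | v
  · trivial
  · trivial
  · trivial
  · exact h.imp (.map _) (.map _)

/-- The projection of the coalgebra of winning plays to one of the two players' sides. -/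
noncomputable def playProj {D : MStruct σ} {N : S → Type u} {ν : ∀ s, N s → D.carrier s}
    (φ : ∀ s, L s × M s → N s)
    (hφ : ∀ R (x : ∀ i, (playCoalg ι κ k).A.carrier (σ.sort R i)), (playCoalg ι κ k).A.rel R x →
      D.rel R fun i => wordEval D ν k _ (elemMap σ φ _ (x i).1)) :
    playCoalg ι κ k ⟶ wordCoalg D N ν k :=
  mkHom (X := playCoalg ι κ k) (Y := wordCoalg D N ν k)
    (⟨fun s x => elemMap σ φ s x.1, fun _ _ => rfl, fun R x hx =>
      ⟨fun i j => (hx.1 i j).elemMap φ, hφ R x hx⟩⟩ :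
        MStruct.Hom (playCoalg ι κ k).A (wordStruct D N ν k))
    (fun s x w hw => by
      obtain ⟨v, hv, e⟩ := branch_wordCoalg.1 (branch_playCoalg.1 hw)
      refine branch_wordCoalg.2 ⟨⟨v.1.map φ, (Word.length_map _ _).trans_le v.2⟩, ?_, ?_⟩
      · change elemMap σ φ s x.1 = _
        rw [hv]
        rfl
      · rw [← map_prefixWord, ← e]
        exact (Word.map_map (fun s (a : (playCoalg ι κ k).A.carrier s) => a.1)
          (elemMap σ φ) w).symm)

/-- Positions of `playCoalg` are winning plays and one-step extensions are single letters, so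
lifting reduces to `hs`: any letter on one side can be completed to a pair that keeps the play
winning. -/
theorem liftsExtensions_playProj {D : MStruct σ} {N : S → Type u}
    {ν : ∀ s, N s → D.carrier s} (φ : ∀ s, L s × M s → N s) (hφ)
    (hs : ∀ (o : Word.Opt fun s => L s × M s), Winning ι κ k o → Word.olength o < k →
      ∀ s (n : N s), ∃ p : L s × M s, φ s p = n ∧
        Winning ι κ k (some ⟨s, Word.append o p⟩)) :
    LiftsExtensions (playProj (ι := ι) (κ := κ) (ν := ν) (k := k) φ hφ) := by
  intro o ho s y hy
  let incl := subIncl (pairCoalg ι M k) (WinningElem ι κ k)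
    (fun _ _ _ h => by cases h) WinningElem.last
  obtain ⟨u, hu, e⟩ := exists_prefixPos (ho.map incl)
  have e' : Word.omap (MStruct.fn (playProj (ι := ι) (κ := κ) (ν := ν) (k := k) φ hφ).f) o =
      prefixPos σ (Word.omap φ u) ((Word.olength_omap _ _).trans_le hu) := by
    rw [← omap_prefixPos φ hu, ← e]
    exact (Word.omap_omap (MStruct.fn incl.f) (elemMap σ φ) o).symm
  rw [e'] at hy
  obtain ⟨n, h', rfl⟩ := (branch_append_wordCoalg _).1 hy
  -- The last element of a non-empty position is the play `u` itself, and membership in `playCoalg`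
  -- says that it is winning.
  have hwin : Winning ι κ k u := by
    rcases o with _ | ⟨t, w⟩
    · rcases u with _ | u
      · rintro _ _ ⟨_, ⟨⟩, _⟩
      · cases e
    · rcases u with _ | ⟨t', u⟩
      · cases e
      · obtain ⟨rfl, e⟩ := Sigma.mk.inj (Option.some_injective _ e)
        have := congrArg Word.last (eq_of_heq e)
        rw [Word.last_map] at this
        exact w.last.2 _ (this.trans (last_prefixWord u hu))
  have hlen : Word.olength u < k := by
    rw [Word.length_append, Word.olength_omap] at h'
    exact h'
  obtain ⟨p, rfl, hp⟩ := hs u hwin hlen s n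
  let x : (playCoalg ι κ k).A.carrier s :=
    ⟨Sum.inr ⟨Word.append u p, length_append_le hlen p⟩, fun w hw => by
      obtain rfl := Sum.inr_injective hw
      exact hp⟩
  refine ⟨x, ?_, ?_⟩
  · refine branch_playCoalg.2 ?_
    have e2 := Word.map_append (MStruct.fn incl.f) o x
    rw [e] at e2
    have := (branch_append_wordCoalg (A := A) (ι := fun s p => ι s p.1) hu (y := x.1)).2
      ⟨p, length_append_le hlen p, rfl⟩
    exact e2.symm ▸ this
  · exact congrArg Sum.inr (Subtype.ext (Word.map_append φ u p))

/-- Comparable plays are prefixes of one winning play. The pairs of that play, with the pairs of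
constants, form a partial isomorphism, so `A` and `B` agree on the tuple of last pairs. -/
theorem rel_iff_of_compat (hk : Game ι κ k (constPairs A B)) {R : σ.Rel}
    (x : ∀ i, (playCoalg ι κ k).A.carrier (σ.sort R i))
    (hx : ∀ i j, Compat (playCoalg ι κ k) (x i) (x j)) :
    A.rel R (fun i => wordEval A (fun s (p : L s × M s) => ι s p.1) k _ (x i).1) ↔
      B.rel R (fun i => wordEval B (fun s (p : L s × M s) => κ s p.2) k _ (x i).1) := by
  obtain ⟨o, ho, hox⟩ := exists_position x hx
  obtain ⟨u, hu, hb⟩ : ∃ u, Winning ι κ k u ∧ ∀ s (y : (playCoalg ι κ k).A.carrier s)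
      (v : BWord (fun s => L s × M s) k s), OnPath o s y → y.1 = Sum.inr v → v.1.Below u := by
    rcases o with _ | ⟨t, w⟩
    · refine ⟨none, by rintro _ _ ⟨_, ⟨⟩, _⟩, ?_⟩
      rintro s y v (⟨c, rfl⟩ | ⟨_, _, _, ⟨⟩, _⟩) hv
      cases hv
    · have hw := ho _ rfl
      obtain ⟨u, hu, e⟩ := branch_wordCoalg.1 (branch_playCoalg.1 hw)
      refine ⟨some ⟨t, u.1⟩, w.last.2 u hu, ?_⟩
      rintro s y v (⟨c, rfl⟩ | ⟨w', hw', _, ⟨⟩, hb⟩) hv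
      · cases hv
      · obtain ⟨v', hv', e'⟩ := branch_wordCoalg.1 (branch_playCoalg.1 hw')
        rw [hv] at hv'
        obtain rfl := Sum.inr_injective hv'
        have := hb.map (fun s (a : (playCoalg ι κ k).A.carrier s) => a.1)
        refine ⟨_, rfl, (isPrefix_prefixWord (σ := σ) (hw := v.2) (hv := u.2)).1 ?_⟩
        rw [← e, ← e']
        exact this
  refine (hu.game hk).partialIso R _ _ fun i => ?_
  have hi := hb _ (x i)
  rcases h : (x i).1 with c | v
  · exact .inl ⟨c, rfl, rfl⟩
  · exact .inr ⟨v.1, hi v (hox i) h, rfl, rfl⟩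

theorem wordEval_elemMap {D : MStruct σ} {N : S → Type u} {ν : ∀ s, N s → D.carrier s}
    (φ : ∀ s, L s → N s) {s : S} (x : σ.Const s ⊕ BWord L k s) :
    wordEval D ν k s (elemMap σ φ s x) = wordEval D (fun s a => ν s (φ s a)) k s x := by
  rcases x with c | w
  · rfl
  · exact congrArg (ν s) (Word.last_map φ w.1)

theorem rel_elemMap_iff {D : MStruct σ} {N : S → Type u} {ν : ∀ s, N s → D.carrier s}
    (φ : ∀ s, L s → N s) {R : σ.Rel} (x : ∀ i, σ.Const (σ.sort R i) ⊕ BWord L k (σ.sort R i)) :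
    (D.rel R fun i => wordEval D ν k _ (elemMap σ φ _ (x i))) ↔
      D.rel R fun i => wordEval D (fun s a => ν s (φ s a)) k _ (x i) := by
  simp only [wordEval_elemMap]

/-- Bisimilarity of coalgebras of words is a winning strategy for Duplicator. -/
theorem coalgBisimilar_wordCoalg_iff :
    CoalgBisimilar (MStruct.embeddings σ) (EFPath σ k) (wordCoalg A L ι k)
      (wordCoalg B M κ k) ↔ Game ι κ k (constPairs A B) := by
  constructor
  · rintro ⟨W, f, g, hf, hg⟩
    rw [open_pathwise_iff] at hf hg
    refine (game_spanPairs hf hg k none ?_ (Nat.zero_add k).le).mono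
      (constPairs_subset_spanPairs none)
    rintro _ ⟨⟩
  · intro hk
    -- The apex carries the relations of `A`: the first projection preserves and reflects them
    -- directly, the second through `rel_iff_of_compat`.
    refine ⟨playCoalg ι κ k, playProj (fun _ p => p.1) fun R x hx => ?_,
      playProj (fun _ p => p.2) fun R x hx => ?_, open_pathwise_iff.2 ⟨?_, ?_⟩,
      open_pathwise_iff.2 ⟨?_, ?_⟩⟩
    · exact (rel_elemMap_iff _ _).2 hx.2
    · exact (rel_elemMap_iff _ _).2 <| (rel_iff_of_compat hk x fun i j => compat_of_rel hx i j).1 hx.2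
    · intro R x hx h
      refine ⟨fun i j => compat_playCoalg (hx i j), ?_⟩
      exact (rel_elemMap_iff _ fun i => (x i).1).1 h.2
    · refine liftsExtensions_playProj _ _ fun o ho hl s a => ?_
      obtain ⟨b, hb⟩ := ho.forth hk hl a
      exact ⟨(a, b), rfl, hb⟩
    · intro R x hx h
      refine ⟨fun i j => compat_playCoalg (hx i j), (rel_iff_of_compat hk x hx).2 ?_⟩
      exact (rel_elemMap_iff _ fun i => (x i).1).1 h.2
    · refine liftsExtensions_playProj _ _ fun o ho hl s b => ?_
      obtain ⟨a, ha⟩ := ho.back hk hl b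
      exact ⟨(a, b), rfl, ha⟩

end ToSpan

end Game

/-! ### Games on standard models -/

section MSO

variable {σ : Sig.{u}} {A B : RStruct σ}

/-- Pairs of elements and pairs of subsets of two structures. -/
abbrev PairSet (A B : RStruct σ) : Type u :=
  Set (Σ s, (trE A).carrier s × (trE B).carrier s)

/-- A pair of elements as a pair of sort `fst`. -/
def elemPair (a : A.carrier) (b : B.carrier) : Σ s, (trE A).carrier s × (trE B).carrier s :=
  ⟨.fst, a, b⟩

/-- A pair of subsets as a pair of sort `snd`. -/
def setPair (M : Set A.carrier) (N : Set B.carrier) :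
    Σ s, (trE A).carrier s × (trE B).carrier s :=
  ⟨.snd, M, N⟩

theorem partialIso_trE_iff {P : PairSet A B} : PartialIso P ↔
    (∀ (R : σ.Rel) x y, (∀ i, elemPair (x i) (y i) ∈ P) → (A.rel R x ↔ B.rel R y)) ∧
    (∀ a b M N, elemPair a b ∈ P → setPair M N ∈ P → (a ∈ M ↔ b ∈ N)) ∧
    (∀ a b a' b', elemPair a b ∈ P → elemPair a' b' ∈ P → (a = a' ↔ b = b')) := by
  constructor
  · intro h
    refine ⟨fun R x y hxy => h (.base R) x y hxy, fun a b M N hab hMN => ?_,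
      fun a b a' b' hab hab' => ?_⟩
    · refine h .e (fun i : Fin 2 => match i with | 0 => a | 1 => M)
        (fun i : Fin 2 => match i with | 0 => b | 1 => N) fun i : Fin 2 => ?_
      match i with
      | 0 => exact hab
      | 1 => exact hMN
    · refine h .I (fun i : Fin 2 => match i with | 0 => a | 1 => a')
        (fun i : Fin 2 => match i with | 0 => b | 1 => b') fun i : Fin 2 => ?_
      match i with
      | 0 => exact hab
      | 1 => exact hab'
  · rintro ⟨h1, h2, h3⟩ (R | _ | _) x y hxy
    · exact h1 R x y hxy
    · exact h2 _ _ _ _ (hxy (0 : Fin 2)) (hxy (1 : Fin 2))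
    · exact h3 _ _ _ _ (hxy (0 : Fin 2)) (hxy (1 : Fin 2))

/-- The game on standard models in which all the elements may be chosen. -/
abbrev FullGame (r : ℕ) (P : PairSet A B) : Prop :=
  Game (A := trE A) (B := trE B) (fun _ a => a) (fun _ b => b) r P

/-- The game on standard models in which only non-constant elements may be chosen. -/
abbrev NCGame (r : ℕ) (P : PairSet A B) : Prop :=
  Game (A := trE A) (B := trE B) (L := ncLetters (trE A)) (M := ncLetters (trE B))
    (fun _ a => a.1) (fun _ b => b.1) r P

/-- A strategy for more rounds also wins fewer; this accounts for a round wasted on a constant. -/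
theorem Game.of_succ {S : Type} {τ : MSig.{u} S} {A B : MStruct τ} {L M : S → Type u}
    {ι : ∀ s, L s → A.carrier s} {κ : ∀ s, M s → B.carrier s} :
    ∀ {r : ℕ} {P : Set (Σ s, A.carrier s × B.carrier s)}, Game ι κ (r + 1) P → Game ι κ r P
  | 0, _, h => h.1
  | _ + 1, _, h => ⟨h.1, fun s =>
      ⟨fun a => let ⟨b, hb⟩ := (h.2 s).1 a; ⟨b, hb.of_succ⟩,
        fun b => let ⟨a, ha⟩ := (h.2 s).2 b; ⟨a, ha.of_succ⟩⟩⟩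

/-- The relation `I` holds between `a` and a constant iff it holds between `b` and the same
constant. There are no constants of sort `snd`. -/
theorem nonConst_iff {P : PairSet A B} (hP : constPairs (trE A) (trE B) ⊆ P)
    (h : PartialIso P) {s : MSOSort} {a : (trE A).carrier s} {b : (trE B).carrier s}
    (hab : ⟨s, a, b⟩ ∈ P) : (trE A).NonConst a ↔ (trE B).NonConst b := by
  refine forall_congr' fun c => not_congr ?_
  cases s with
  | fst => exact (partialIso_trE_iff.1 h).2.2 _ _ _ _ (hP ⟨c, rfl, rfl⟩) hab
  | snd => exact c.elim

/-- If Spoiler picks a constant, Duplicator answers with the same constant, whose pair is already in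
`P`, and a round is lost. If Spoiler picks a non-constant element, the winning answer in the full
game is non-constant by `nonConst_iff`. -/
theorem ncGame_iff_fullGame : ∀ {r : ℕ} {P : PairSet A B},
    constPairs (trE A) (trE B) ⊆ P → (NCGame r P ↔ FullGame r P)
  | 0, _, _ => Iff.rfl
  | r + 1, P, hP => by
    have ih : ∀ {Q : PairSet A B}, P ⊆ Q → (NCGame r Q ↔ FullGame r Q) :=
      fun hQ => ncGame_iff_fullGame (hP.trans hQ)
    constructor
    · intro h
      refine ⟨h.1, fun s => ⟨fun a => ?_, fun b => ?_⟩⟩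
      · by_cases ha : (trE A).NonConst a
        · obtain ⟨b, hb⟩ := (h.2 s).1 ⟨a, ha⟩
          exact ⟨b.1, (ih (Set.subset_insert _ _)).1 hb⟩
        · obtain ⟨c, rfl⟩ := not_forall_not.1 ha
          refine ⟨(trE B).const s c, ?_⟩
          rw [Set.insert_eq_of_mem (hP ⟨c, rfl, rfl⟩)]
          exact (ih subset_rfl).1 h.of_succ
      · by_cases hb : (trE B).NonConst b
        · obtain ⟨a, ha⟩ := (h.2 s).2 ⟨b, hb⟩
          exact ⟨a.1, (ih (Set.subset_insert _ _)).1 ha⟩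
        · obtain ⟨c, rfl⟩ := not_forall_not.1 hb
          refine ⟨(trE A).const s c, ?_⟩
          rw [Set.insert_eq_of_mem (hP ⟨c, rfl, rfl⟩)]
          exact (ih subset_rfl).1 h.of_succ
    · intro h
      refine ⟨h.1, fun s => ⟨fun a => ?_, fun b => ?_⟩⟩
      · obtain ⟨b, hb⟩ := (h.2 s).1 a.1
        have := nonConst_iff (hP.trans (Set.subset_insert _ _)) hb.partialIso
          (Set.mem_insert _ _)
        exact ⟨⟨b, this.1 a.2⟩, (ih (Set.subset_insert _ _)).2 hb⟩
      · obtain ⟨a, ha⟩ := (h.2 s).2 b.1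
        have := nonConst_iff (hP.trans (Set.subset_insert _ _)) ha.partialIso
          (Set.mem_insert _ _)
        exact ⟨⟨a, this.2 b.2⟩, (ih (Set.subset_insert _ _)).2 ha⟩

/-- Induction on the formula: atomic formulas hold alike by the partial isomorphism, and each
quantifier uses one round, the answer being the witness on the other side. -/
theorem sat_iff_of_game : ∀ {n m : ℕ} (φ : Formula σ n m) {r : ℕ}, φ.rank ≤ r →
    ∀ {P : PairSet A B} {v : Fin n → A.carrier} {v' : Fin n → B.carrier}
      {V : Fin m → Set A.carrier} {V' : Fin m → Set B.carrier},
      (∀ t : Term σ n, elemPair (t.eval A v) (t.eval B v') ∈ P) →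
      (∀ j, setPair (V j) (V' j) ∈ P) → FullGame r P → (φ.Sat A v V ↔ φ.Sat B v' V')
  | _, _, .falsum, _, _, _, _, _, _, _, _, _, _ => Iff.rfl
  | _, _, .eq t t', _, _, _, _, _, _, _, ht, _, h =>
    (partialIso_trE_iff.1 h.partialIso).2.2 _ _ _ _ (ht t) (ht t')
  | _, _, .mem t X, _, _, _, _, _, _, _, ht, hV, h =>
    (partialIso_trE_iff.1 h.partialIso).2.1 _ _ _ _ (ht t) (hV X)
  | _, _, .rel R t, _, _, _, _, _, _, _, ht, _, h =>
    (partialIso_trE_iff.1 h.partialIso).1 R _ _ fun i => ht (t i)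
  | _, _, .neg φ, _, hr, _, _, _, _, _, ht, hV, h => not_congr (sat_iff_of_game φ hr ht hV h)
  | _, _, .and φ ψ, _, hr, _, _, _, _, _, ht, hV, h =>
    and_congr (sat_iff_of_game φ ((le_max_left _ _).trans hr) ht hV h)
      (sat_iff_of_game ψ ((le_max_right _ _).trans hr) ht hV h)
  | n, m, .exElem φ, 0, hr, _, _, _, _, _, _, _, _ => absurd hr (Nat.not_succ_le_zero _)
  | n, m, .exElem φ, r + 1, hr, P, v, v', V, V', ht, hV, h => by
    have key : ∀ a b, FullGame r (insert (elemPair a b) P) →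
        (φ.Sat A (Fin.cons (α := fun _ => A.carrier) a v) V ↔
          φ.Sat B (Fin.cons (α := fun _ => B.carrier) b v') V') := by
      intro a b hg
      refine sat_iff_of_game φ (Nat.le_of_succ_le_succ hr) (fun t => ?_)
        (fun j => .inr (hV j)) hg
      rcases t with c | i
      · exact .inr (ht (.const c))
      · refine Fin.cases ?_ (fun i => ?_) i
        · exact .inl rfl
        · exact .inr (ht (.var i))
    constructor
    · rintro ⟨a, ha⟩
      obtain ⟨b, hb⟩ := (h.2 .fst).1 a
      exact ⟨b, (key a b hb).1 ha⟩
    · rintro ⟨b, hb⟩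
      obtain ⟨a, ha⟩ := (h.2 .fst).2 b
      exact ⟨a, (key a b ha).2 hb⟩
  | n, m, .exSet φ, 0, hr, _, _, _, _, _, _, _, _ => absurd hr (Nat.not_succ_le_zero _)
  | n, m, .exSet φ, r + 1, hr, P, v, v', V, V', ht, hV, h => by
    have key : ∀ M N, FullGame r (insert (setPair M N) P) →
        (φ.Sat A v (Fin.cons (α := fun _ => Set A.carrier) M V) ↔
          φ.Sat B v' (Fin.cons (α := fun _ => Set B.carrier) N V')) := by
      intro M N hg
      refine sat_iff_of_game φ (Nat.le_of_succ_le_succ hr) (fun t => .inr (ht t))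
        (fun j => ?_) hg
      refine Fin.cases ?_ (fun i => ?_) j
      · exact .inl rfl
      · exact .inr (hV i)
    constructor
    · rintro ⟨M, hM⟩
      obtain ⟨N, hN⟩ := (h.2 .snd).1 M
      exact ⟨N, (key M N hN).1 hM⟩
    · rintro ⟨N, hN⟩
      obtain ⟨M, hM⟩ := (h.2 .snd).2 N
      exact ⟨M, (key M N hM).2 hN⟩

/-! ### Formulas that determine the game -/

/-- The conjunctions that contain each formula of a list or its negation. -/
def Formula.literalConj {n m : ℕ} : List (Formula σ n m) → List (Formula σ n m)
  | [] => [.neg .falsum]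
  | φ :: l => (literalConj l).map (.and φ) ++ (literalConj l).map (.and (.neg φ))

theorem Formula.rank_literalConj {n m r : ℕ} : ∀ {l : List (Formula σ n m)},
    (∀ φ ∈ l, φ.rank ≤ r) → ∀ ψ ∈ literalConj l, ψ.rank ≤ r
  | [], _, ψ, hψ => by
    rw [List.mem_singleton.1 hψ]
    exact Nat.zero_le _
  | φ :: l, h, ψ, hψ => by
    have ih := rank_literalConj fun χ hχ => h χ (List.mem_cons_of_mem _ hχ)
    have hφ := h φ List.mem_cons_self
    rcases List.mem_append.1 hψ with hψ | hψ
    · obtain ⟨χ, hχ, rfl⟩ := List.mem_map.1 hψ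
      exact max_le hφ (ih χ hχ)
    · obtain ⟨χ, hχ, rfl⟩ := List.mem_map.1 hψ
      exact max_le hφ (ih χ hχ)

/-- The conjunction collects the truth values of the formulas of `l` in `A`. It serves as a
description of Spoiler's move, to be realised in the other structure. -/
theorem Formula.exists_sat_literalConj {n m : ℕ} (v : Fin n → A.carrier)
    (V : Fin m → Set A.carrier) : ∀ l : List (Formula σ n m), ∃ ψ ∈ literalConj l, ψ.Sat A v V
  | [] => ⟨_, List.mem_singleton.2 rfl, id⟩
  | φ :: l => by
    obtain ⟨ψ, hψ, h⟩ := exists_sat_literalConj v V l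
    by_cases hφ : φ.Sat A v V
    · exact ⟨_, List.mem_append_left _ (List.mem_map_of_mem hψ), hφ, h⟩
    · exact ⟨_, List.mem_append_right _ (List.mem_map_of_mem hψ), hφ, h⟩

theorem Formula.sat_iff_of_literalConj {n m : ℕ} {v : Fin n → A.carrier}
    {V : Fin m → Set A.carrier} {v' : Fin n → B.carrier} {V' : Fin m → Set B.carrier} :
    ∀ {l : List (Formula σ n m)}, ∀ ψ ∈ literalConj l, ψ.Sat A v V → ψ.Sat B v' V' →
      ∀ φ ∈ l, (φ.Sat A v V ↔ φ.Sat B v' V')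
  | [], _, _, _, _, φ, hφ => absurd hφ List.not_mem_nil
  | χ :: l, ψ, hψ, hA, hB, φ, hφ => by
    rcases List.mem_append.1 hψ with hψ | hψ
    · obtain ⟨θ, hθ, rfl⟩ := List.mem_map.1 hψ
      rcases List.mem_cons.1 hφ with rfl | hφ
      · exact iff_of_true hA.1 hB.1
      · exact sat_iff_of_literalConj θ hθ hA.2 hB.2 φ hφ
    · obtain ⟨θ, hθ, rfl⟩ := List.mem_map.1 hψ
      rcases List.mem_cons.1 hφ with rfl | hφ
      · exact iff_of_false hA.1 hB.1
      · exact sat_iff_of_literalConj θ hθ hA.2 hB.2 φ hφ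

/-- The pairs of values of terms and of set variables under two assignments. -/
def valuePairs {n m : ℕ} (v : Fin n → A.carrier) (v' : Fin n → B.carrier)
    (V : Fin m → Set A.carrier) (V' : Fin m → Set B.carrier) : PairSet A B :=
  {p | (∃ t : Term σ n, elemPair (t.eval A v) (t.eval B v') = p) ∨
    ∃ j, setPair (V j) (V' j) = p}

theorem elemPair_mem_valuePairs {n m : ℕ} {v : Fin n → A.carrier} {v' : Fin n → B.carrier}
    {V : Fin m → Set A.carrier} {V' : Fin m → Set B.carrier} {a : A.carrier} {b : B.carrier}
    (h : elemPair a b ∈ valuePairs v v' V V') :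
    ∃ t : Term σ n, t.eval A v = a ∧ t.eval B v' = b := by
  rcases h with ⟨t, h⟩ | ⟨j, h⟩
  · have := Prod.ext_iff.1 (eq_of_heq (Sigma.mk.inj h).2)
    exact ⟨t, this⟩
  · cases congrArg Sigma.fst h

theorem setPair_mem_valuePairs {n m : ℕ} {v : Fin n → A.carrier} {v' : Fin n → B.carrier}
    {V : Fin m → Set A.carrier} {V' : Fin m → Set B.carrier} {M : Set A.carrier}
    {N : Set B.carrier} (h : setPair M N ∈ valuePairs v v' V V') : ∃ j, V j = M ∧ V' j = N := by
  rcases h with ⟨t, h⟩ | ⟨j, h⟩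
  · cases congrArg Sigma.fst h
  · have := Prod.ext_iff.1 (eq_of_heq (Sigma.mk.inj h).2)
    exact ⟨j, this⟩

theorem insert_elemPair_subset {n m : ℕ} (v : Fin n → A.carrier) (v' : Fin n → B.carrier)
    (V : Fin m → Set A.carrier) (V' : Fin m → Set B.carrier) (a : A.carrier) (b : B.carrier) :
    insert (elemPair a b) (valuePairs v v' V V') ⊆
      valuePairs (Fin.cons (α := fun _ => A.carrier) a v)
        (Fin.cons (α := fun _ => B.carrier) b v') V V' := by
  rintro p (rfl | ⟨c | i, rfl⟩ | ⟨j, rfl⟩)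
  · exact .inl ⟨.var 0, rfl⟩
  · exact .inl ⟨.const c, rfl⟩
  · exact .inl ⟨.var i.succ, rfl⟩
  · exact .inr ⟨j, rfl⟩

theorem insert_setPair_subset {n m : ℕ} (v : Fin n → A.carrier) (v' : Fin n → B.carrier)
    (V : Fin m → Set A.carrier) (V' : Fin m → Set B.carrier) (M : Set A.carrier)
    (N : Set B.carrier) :
    insert (setPair M N) (valuePairs v v' V V') ⊆
      valuePairs v v' (Fin.cons (α := fun _ => Set A.carrier) M V)
        (Fin.cons (α := fun _ => Set B.carrier) N V') := by
  rintro p (rfl | ⟨t, rfl⟩ | ⟨j, rfl⟩)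
  · exact .inr ⟨0, rfl⟩
  · exact .inl ⟨t, rfl⟩
  · exact .inr ⟨j.succ, rfl⟩

variable [Finite σ.Const] [Finite σ.Rel]

instance (n : ℕ) : Finite (Term σ n) :=
  Finite.of_surjective (Sum.elim Term.const Term.var) fun t => by
    rcases t with c | i
    · exact ⟨.inl c, rfl⟩
    · exact ⟨.inr i, rfl⟩

variable (σ) in
-- This is where finiteness of the signature enters: there are finitely many terms, hence finitely
-- many atomic formulas in given variables.
theorem exists_atoms (n m : ℕ) : ∃ l : List (Formula σ n m), (∀ φ ∈ l, φ.rank = 0) ∧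
    (∀ t t', .eq t t' ∈ l) ∧ (∀ t X, .mem t X ∈ l) ∧ ∀ R t, .rel R t ∈ l := by
  have h1 := Set.finite_range fun p : Term σ n × Term σ n => (.eq p.1 p.2 : Formula σ n m)
  have h2 := Set.finite_range fun p : Term σ n × Fin m => (.mem p.1 p.2 : Formula σ n m)
  have h3 := Set.finite_range fun p : Σ R : σ.Rel, Fin (σ.arity R) → Term σ n =>
    (.rel p.1 p.2 : Formula σ n m)
  refine ⟨h1.toFinset.toList ++ h2.toFinset.toList ++ h3.toFinset.toList, ?_, ?_, ?_, ?_⟩ <;>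
    simp only [List.mem_append, Finset.mem_toList, Set.Finite.mem_toFinset]
  · rintro φ ((⟨p, rfl⟩ | ⟨p, rfl⟩) | ⟨p, rfl⟩) <;> rfl
  · exact fun t t' => .inl (.inl ⟨(t, t'), rfl⟩)
  · exact fun t X => .inl (.inr ⟨(t, X), rfl⟩)
  · exact fun R t => .inr ⟨⟨R, t⟩, rfl⟩

variable (σ) in
/-- Finitely many formulas of rank at most `r` determine who wins the `r`-round game. -/
theorem exists_formulas_game : ∀ r n m : ℕ, ∃ l : List (Formula σ n m), (∀ φ ∈ l, φ.rank ≤ r) ∧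
    ∀ (A B : RStruct σ) (v : Fin n → A.carrier) (v' : Fin n → B.carrier)
      (V : Fin m → Set A.carrier) (V' : Fin m → Set B.carrier),
      (∀ φ ∈ l, (φ.Sat A v V ↔ φ.Sat B v' V')) → FullGame r (valuePairs v v' V V') := by
  have atomic : ∀ n m : ℕ, ∃ l : List (Formula σ n m), (∀ φ ∈ l, φ.rank = 0) ∧
    ∀ (A B : RStruct σ) (v : Fin n → A.carrier) (v' : Fin n → B.carrier)
      (V : Fin m → Set A.carrier) (V' : Fin m → Set B.carrier),
      (∀ φ ∈ l, (φ.Sat A v V ↔ φ.Sat B v' V')) → PartialIso (valuePairs v v' V V') := by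
    intro n m
    obtain ⟨l, hl, h1, h2, h3⟩ := exists_atoms σ n m
    refine ⟨l, hl, fun A B v v' V V' h => partialIso_trE_iff.2 ⟨?_, ?_, ?_⟩⟩
    · intro R x y hxy
      choose t ht using fun i => elemPair_mem_valuePairs (hxy i)
      obtain rfl : (fun i => (t i).eval A v) = x := funext fun i => (ht i).1
      obtain rfl : (fun i => (t i).eval B v') = y := funext fun i => (ht i).2
      exact h _ (h3 R t)
    · intro a b M N hab hMN
      obtain ⟨t, rfl, rfl⟩ := elemPair_mem_valuePairs hab
      obtain ⟨j, rfl, rfl⟩ := setPair_mem_valuePairs hMN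
      exact h _ (h2 t j)
    · intro a b a' b' hab hab'
      obtain ⟨t, rfl, rfl⟩ := elemPair_mem_valuePairs hab
      obtain ⟨t', rfl, rfl⟩ := elemPair_mem_valuePairs hab'
      exact h _ (h1 t t')
  intro r
  induction r with
  | zero =>
    intro n m
    obtain ⟨l, hl, h⟩ := atomic n m
    exact ⟨l, fun φ hφ => (hl φ hφ).le, h⟩
  | succ r ih =>
    intro n m
    obtain ⟨l₀, hl₀, h₀⟩ := atomic n m
    obtain ⟨l₁, hl₁, h₁⟩ := ih (n + 1) m
    obtain ⟨l₂, hl₂, h₂⟩ := ih n (m + 1)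
    -- For every complete description of a choice of an element or a set, in terms of the formulas
    -- for `r` rounds, the list says that such a choice exists. Spoiler's choice satisfies one
    -- description, and Duplicator answers with a witness of the same one.
    refine ⟨l₀ ++ (Formula.literalConj l₁).map .exElem ++ (Formula.literalConj l₂).map .exSet,
      fun φ hφ => ?_, fun A B v v' V V' h => ⟨h₀ A B v v' V V' fun φ hφ => h φ ?_, ?_⟩⟩
    · simp only [List.mem_append, List.mem_map] at hφ
      rcases hφ with (hφ | ⟨ψ, hψ, rfl⟩) | ⟨ψ, hψ, rfl⟩
      · rw [hl₀ φ hφ]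
        exact Nat.zero_le _
      · exact Nat.succ_le_succ (Formula.rank_literalConj hl₁ ψ hψ)
      · exact Nat.succ_le_succ (Formula.rank_literalConj hl₂ ψ hψ)
    · exact List.mem_append_left _ (List.mem_append_left _ hφ)
    · have hE : ∀ ψ ∈ Formula.literalConj l₁, (ψ.exElem.Sat A v V ↔ ψ.exElem.Sat B v' V') :=
        fun ψ hψ => h _ (List.mem_append_left _ (List.mem_append_right _ (List.mem_map_of_mem hψ)))
      have hS : ∀ ψ ∈ Formula.literalConj l₂, (ψ.exSet.Sat A v V ↔ ψ.exSet.Sat B v' V') :=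
        fun ψ hψ => h _ (List.mem_append_right _ (List.mem_map_of_mem hψ))
      rintro (_ | _)
      · refine ⟨fun a => ?_, fun b => ?_⟩
        · obtain ⟨ψ, hψ, ha⟩ := Formula.exists_sat_literalConj
            (Fin.cons (α := fun _ => A.carrier) a v) V l₁
          obtain ⟨b, hb⟩ := (hE ψ hψ).1 ⟨a, ha⟩
          exact ⟨b, (h₁ A B _ _ _ _ (Formula.sat_iff_of_literalConj ψ hψ ha hb)).mono
            (insert_elemPair_subset v v' V V' a b)⟩
        · obtain ⟨ψ, hψ, hb⟩ := Formula.exists_sat_literalConj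
            (Fin.cons (α := fun _ => B.carrier) b v') V' l₁
          obtain ⟨a, ha⟩ := (hE ψ hψ).2 ⟨b, hb⟩
          exact ⟨a, (h₁ A B _ _ _ _ (Formula.sat_iff_of_literalConj ψ hψ ha hb)).mono
            (insert_elemPair_subset v v' V V' a b)⟩
      · refine ⟨fun M => ?_, fun N => ?_⟩
        · obtain ⟨ψ, hψ, hM⟩ := Formula.exists_sat_literalConj v
            (Fin.cons (α := fun _ => Set A.carrier) M V) l₂
          obtain ⟨N, hN⟩ := (hS ψ hψ).1 ⟨M, hM⟩
          exact ⟨N, (h₂ A B _ _ _ _ (Formula.sat_iff_of_literalConj ψ hψ hM hN)).mono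
            (insert_setPair_subset v v' V V' M N)⟩
        · obtain ⟨ψ, hψ, hN⟩ := Formula.exists_sat_literalConj v'
            (Fin.cons (α := fun _ => Set B.carrier) N V') l₂
          obtain ⟨M, hM⟩ := (hS ψ hψ).2 ⟨N, hN⟩
          exact ⟨M, (h₂ A B _ _ _ _ (Formula.sat_iff_of_literalConj ψ hψ hM hN)).mono
            (insert_setPair_subset v v' V V' M N)⟩

theorem msoEquiv_iff_fullGame {k : ℕ} :
    MSOEquiv k A B ↔ FullGame k (constPairs (trE A) (trE B)) := by
  constructor
  · intro h
    obtain ⟨l, hl, hg⟩ := exists_formulas_game σ k 0 0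
    refine (hg A B Fin.elim0 Fin.elim0 Fin.elim0 Fin.elim0 fun φ hφ => h φ (hl φ hφ)).mono ?_
    -- Under empty assignments the pairs of constants are values of closed terms.
    rintro ⟨_ | _, a, b⟩ ⟨c, h1, h2⟩
    · exact .inl ⟨.const c, congrArg₂ elemPair h1 h2⟩
    · exact c.elim
  · intro h φ hφ
    refine sat_iff_of_game φ hφ (fun t => ?_) (fun j => j.elim0) h
    rcases t with c | i
    · exact ⟨c, rfl, rfl⟩
    · exact i.elim0

end MSO

end MSOGame

theorem mainTheorem2 {σ : MSOGame.Sig.{u}} [Finite σ.Const] [Finite σ.Rel]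
    (k : ℕ) (hk : 0 < k) (A B : MSOGame.RStruct σ) :
    (MSOGame.MSOEquiv k A B ↔ MSOGame.EFBisimilar k (MSOGame.trE A) (MSOGame.trE B)) ∧
      (MSOGame.MSOEquiv k A B ↔
        MSOGame.EFncBisimilar k (MSOGame.trEnc A) (MSOGame.trEnc B)) := by
  rw [MSOGame.msoEquiv_iff_fullGame]
  -- The cofree `𝔼_k`-coalgebra is by definition the word coalgebra in which all elements are
  -- letters.
  refine ⟨MSOGame.coalgBisimilar_wordCoalg_iff.symm, ?_⟩
  rw [MSOGame.efncBisimilar_iff, MSOGame.forgetNC_cofree_eq_wordCoalg,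
    MSOGame.forgetNC_cofree_eq_wordCoalg, MSOGame.coalgBisimilar_wordCoalg_iff]
  exact (MSOGame.ncGame_iff_fullGame subset_rfl).symm
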